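/- Let $d\ge 1$, let $\boldsymbol\Sigma_0\in\mathbb R^{d\times d}$ be symmetric positive definite with spectral decomposition $\boldsymbol\Sigma_0=\sum_{i=1}^d\lambda_i(0)\,\boldsymbol v_i\boldsymbol v_i^\top$, where $\lambda_1(0)\ge\dots\ge\lambda_d(0)>0$ and $(\boldsymbol v_i)$ is orthonormal, and let $\sigma>0$. For unit vectors $\boldsymbol y_1,\dots,\boldsymbol y_m\in\mathbb R^d$ (queries answered with Gaussian noise of variance $\sigma^2$) the posterior covariance $\boldsymbol\Sigma_m$ is given by $\boldsymbol\Sigma_m^{-1}=\boldsymbol\Sigma_0^{-1}+\sigma^{-2}\sum_{t=1}^m\boldsymbol y_t\boldsymbol y_t^\top$; a matrix arising in this way is called a feasible posterior. For $k\ge1$ let $$D_k(\boldsymbol\Sigma)=\inf_{\boldsymbol x_1,\dots,\boldsymbol x_k\in\mathbb R^d}\ \mathbb E_{\boldsymbol\xi\sim\mathcal N(\boldsymbol 0,\boldsymbol\Sigma)}\Bigl[\min_{j\le k}\|\boldsymbol\xi-\boldsymbol x_j\|_2^2\Bigr],$$ and let a $k$-optimal posterior be a feasible posterior $\boldsymbol\Sigma_m^{\star,k}$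 that minimizes $D_k$ over all feasible posteriors. The rank-capped water-filling posterior $\boldsymbol\Sigma_m^{\star,1}$ (which is designed for $k=1$) is defined as follows. For $0\le r\le\min\{m,d\}$ put $\lambda(r)=r/\bigl(\sum_{i=1}^r\lambda_i(0)^{-1}+m/\sigma^2\bigr)$, and let $r^\star\le\min\{m,d\}$ be the unique index such that $\lambda(r^\star)<\lambda_{r^\star}(0)$ (no condition if $r^\star=0$) and, if $r^\star<\min\{m,d\}$, $\lambda(r^\star)\ge\lambda_{r^\star+1}(0)$. Then $$\boldsymbol\Sigma_m^{\star,1}=\sum_{i\le r^\star}\lambda(r^\star)\,\boldsymbol v_i\boldsymbol v_i^\top+\sum_{i>r^\star}\lambda_i(0)\,\boldsymbol v_i\boldsymbol v_i^\top .$$ The same formulas define $\boldsymbol\Sigma_m^{\star,1}$ for every real $m\ge0$, with cap $\min\{\lfloor m\rfloor,d\}$. For positive definite $\boldsymbol\Sigma$ define the isoperimetric ratio $$\alpha(\boldsymbol\Sigma)=\frac{\operatorname{tr}\boldsymbol\Sigma}{d\,(\det\boldsymbol\Sigma)^{1/d}} .$$ Then: 1. $\alpha(\boldsymbol\Sigma)\ge1$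 for every positive definite $\boldsymbol\Sigma$, with equality if and only if $\boldsymbol\Sigma$ is a multiple of the identity. 2. For all integers $m\ge0$ and $k\ge2$, every $k$-optimal posterior $\boldsymbol\Sigma_m^{\star,k}$ has $D_k(\boldsymbol\Sigma_m^{\star,k})>0$ and $$\frac{D_k(\boldsymbol\Sigma_m^{\star,1})}{D_k(\boldsymbol\Sigma_m^{\star,k})}\le\alpha(\boldsymbol\Sigma_m^{\star,1})\,k^{2/d};$$ moreover $D_k(\boldsymbol\Sigma_m^{\star,1})\le\alpha(\boldsymbol\Sigma_m^{\star,1})\,k^{2/d}\,D_k(\boldsymbol\Sigma)$ for every feasible posterior $\boldsymbol\Sigma$. 3. The function $m\mapsto\alpha(\boldsymbol\Sigma_m^{\star,1})$ is convex and non-increasing on the real half-line $[d,\infty)$ (in particular along the integers $m\ge d$). 4. $\alpha(\boldsymbol\Sigma_m^{\star,1})=1$ for every real $m\ge\max\{d,\bar m\}$, where $\bar m=\sigma^2\bigl(\frac{d}{\lambda_{\min}(\boldsymbol\Sigma_0)}-\operatorname{tr}(\boldsymbol\Sigma_0^{-1})\bigr)^+$. -/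

import Mathlib

open MeasureTheory ProbabilityTheory Matrix

noncomputable section

namespace SolicitSuggest

variable {d : ℕ}

/-- The posterior covariance after the queries `y 0, …, y (m-1)` (answered with Gaussian noise of
variance `σ ^ 2`) from the prior covariance `S₀`: the precision matrix is
`S₀⁻¹ + σ⁻² ∑ₜ yₜ yₜᵀ`. -/
def posteriorCov (S₀ : Matrix (Fin d) (Fin d) ℝ) (σ : ℝ) {m : ℕ}
    (y : Fin m → EuclideanSpace ℝ (Fin d)) : Matrix (Fin d) (Fin d) ℝ :=
  (S₀⁻¹ + (1 / σ ^ 2) • ∑ t, vecMulVec (y t).ofLp (y t).ofLp)⁻¹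

/-- `S` is the posterior covariance of some sequence of `m` unit query directions. -/
def IsFeasiblePosterior (S₀ : Matrix (Fin d) (Fin d) ℝ) (σ : ℝ) (m : ℕ)
    (S : Matrix (Fin d) (Fin d) ℝ) : Prop :=
  ∃ y : Fin m → EuclideanSpace ℝ (Fin d), (∀ t, ‖y t‖ = 1) ∧ S = posteriorCov S₀ σ y

/-- The Gaussian `k`-point distortion: the optimal mean squared error when a centred Gaussian vector
with covariance `S` is approximated by the nearest of `k` points. -/
def distortion (k : ℕ) (S : Matrix (Fin d) (Fin d) ℝ) : ℝ :=
  ⨅ x : Fin k → EuclideanSpace ℝ (Fin d),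
    ∫ ξ, (⨅ j, ‖ξ - x j‖ ^ 2) ∂(multivariateGaussian (0 : EuclideanSpace ℝ (Fin d)) S)

/-- `S` is a `k`-optimal posterior: it minimises `distortion k` over the posterior covariances that
`m` unit queries can produce. -/
def IsOptimalPosterior (k : ℕ) (S₀ : Matrix (Fin d) (Fin d) ℝ) (σ : ℝ) (m : ℕ)
    (S : Matrix (Fin d) (Fin d) ℝ) : Prop :=
  IsFeasiblePosterior S₀ σ m S ∧
    ∀ S', IsFeasiblePosterior S₀ σ m S' → distortion k S ≤ distortion k S'

/-- The isoperimetric ratio `tr S / (d (det S)^(1/d))`. -/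
def isoperimetricRatio (S : Matrix (Fin d) (Fin d) ℝ) : ℝ :=
  S.trace / (d * S.det ^ (1 / (d : ℝ)))

/-- The equalization level `λ(r) = r / (∑_{i ≤ r} 1/λᵢ + m/σ²)`; `l 0 ≥ l 1 ≥ …` are the prior
eigenvalues, so that the `r` leading ones are the `l i` with `i < r`. -/
def equalizationLevel (l : Fin d → ℝ) (σ m : ℝ) (r : ℕ) : ℝ :=
  r / ((∑ i with i.val < r, (l i)⁻¹) + m / σ ^ 2)

/-- `r` is the number of queried directions of rank-capped water-filling with budget `m`:
`r ≤ min m d`, the level `λ(r)` lies strictly below the `r`-th prior eigenvalue, and, if the cap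
`min m d` is not reached, at or above the next prior eigenvalue. (The budget is a real number so
that the same formulas also interpolate between integer budgets; the cap is then `min ⌊m⌋ d`.) -/
def IsWaterFillingRank (l : Fin d → ℝ) (σ m : ℝ) (r : ℕ) : Prop :=
  r ≤ min ⌊m⌋₊ d ∧
  (∀ i : Fin d, i.val + 1 = r → equalizationLevel l σ m r < l i) ∧
  (r < min ⌊m⌋₊ d → ∀ i : Fin d, i.val = r → l i ≤ equalizationLevel l σ m r)

open Classical in
/-- The index singled out by `IsWaterFillingRank`; see `existsUnique_isWaterFillingRank`. -/
def waterFillingRank (l : Fin d → ℝ) (σ m : ℝ) : ℕ :=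
  Nat.findGreatest (IsWaterFillingRank l σ m) d

/-- The rank-capped water-filling posterior with budget `m`, for the prior covariance
`∑ᵢ lᵢ vᵢ vᵢᵀ`: the variances along the queried leading directions are all equal to the common level,
the other ones stay at their prior values. -/
def waterFillingPosterior (v : Fin d → EuclideanSpace ℝ (Fin d)) (l : Fin d → ℝ) (σ m : ℝ) :
    Matrix (Fin d) (Fin d) ℝ :=
  ∑ i : Fin d,
    (if i.val < waterFillingRank l σ m then equalizationLevel l σ m (waterFillingRank l σ m)
      else l i) • vecMulVec (v i).ofLp (v i).ofLp

/-- The activation threshold `σ² (d / λ_min(S₀) - tr S₀⁻¹)⁺`, with `l` the eigenvalues of `S₀`. -/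
def activationThreshold (S₀ : Matrix (Fin d) (Fin d) ℝ) (l : Fin d → ℝ) (σ : ℝ) : ℝ :=
  σ ^ 2 * max (d / (⨅ i, l i) - (S₀⁻¹).trace) 0

theorem le_equalizationLevel_succ_iff {l : Fin d → ℝ} {σ m : ℝ} (hl : ∀ i, 0 < l i)
    (hσ : 0 < σ) (hm : 0 < m) (i : Fin d) :
    l i ≤ equalizationLevel l σ m (i.val + 1) ↔ l i ≤ equalizationLevel l σ m i.val := by
  have hsum : (∑ j with j.val < i.val + 1, (l j)⁻¹) = (∑ j with j.val < i.val, (l j)⁻¹) + (l i)⁻¹ := by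
    have : (Finset.univ.filter fun j : Fin d => j.val < i.val + 1)
        = insert i (Finset.univ.filter fun j : Fin d => j.val < i.val) := by
      ext j; simp only [Finset.mem_filter, Finset.mem_univ, true_and, Finset.mem_insert, Fin.ext_iff]
      omega
    rw [this, Finset.sum_insert (by simp), add_comm]
  have h0 : 0 ≤ ∑ j with j.val < i.val, (l j)⁻¹ :=
    Finset.sum_nonneg fun j _ => (inv_pos.2 (hl j)).le
  have h1 : 0 < m / σ ^ 2 := by positivity
  have h2 := hl i
  have h3 : l i * (l i)⁻¹ = 1 := mul_inv_cancel₀ h2.ne'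
  have h4 : 0 < (l i)⁻¹ := inv_pos.2 h2
  unfold equalizationLevel
  rw [hsum, le_div_iff₀ (by linarith), le_div_iff₀ (by linarith)]
  push_cast
  constructor <;> intro h <;> nlinarith

/-- The water-filling rank is well defined. -/
theorem existsUnique_isWaterFillingRank {l : Fin d → ℝ} {σ m : ℝ} (hl : ∀ i, 0 < l i)
    (hanti : Antitone l) (hσ : 0 < σ) : ∃! r, IsWaterFillingRank l σ m r := by
  classical
  have hpos : ∀ r : ℕ, r < min ⌊m⌋₊ d → 0 < m := fun r hr => by
    have h : 0 < ⌊m⌋₊ := by omega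
    exact zero_lt_one.trans_le (Nat.floor_pos.1 h)
  let P : ℕ → Prop := fun r => ∀ i : Fin d, i.val + 1 = r → equalizationLevel l σ m r < l i
  have hP0 : P 0 := fun i hi => by omega
  have hx : IsWaterFillingRank l σ m (Nat.findGreatest P (min ⌊m⌋₊ d)) := by
    refine ⟨Nat.findGreatest_le _, Nat.findGreatest_spec (P := P) (Nat.zero_le _) hP0, ?_⟩
    intro hr i hi
    rw [← hi, ← le_equalizationLevel_succ_iff hl hσ (hpos _ hr)]
    by_contra hlt
    have h : P (i.val + 1) := by
      intro j hj
      have : j = i := Fin.ext (by omega)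
      rw [this]; exact not_le.1 hlt
    have := Nat.le_findGreatest (P := P) (n := min ⌊m⌋₊ d) (by omega) h
    omega
  refine ⟨Nat.findGreatest P (min ⌊m⌋₊ d), hx, ?_⟩
  · have key : ∀ r r', IsWaterFillingRank l σ m r → IsWaterFillingRank l σ m r' → ¬ r < r' := by
      intro r r' h h' hlt
      have hcap : r < min ⌊m⌋₊ d := hlt.trans_le h'.1
      have hm := hpos r hcap
      have step : ∀ n, ∀ i : Fin d, i.val = r + n → l i ≤ equalizationLevel l σ m i.val := by
        intro n
        induction n with
        | zero => intro i hi; rw [hi]; exact h.2.2 hcap i hi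
        | succ n ih =>
          intro i hi
          have hj : r + n < d := by omega
          have h1 := ih ⟨r + n, hj⟩ rfl
          rw [← le_equalizationLevel_succ_iff hl hσ hm] at h1
          have h2 : l i ≤ l ⟨r + n, hj⟩ := hanti (Fin.le_def.2 (by simp only; omega))
          have h3 : i.val = r + n + 1 := by omega
          rw [h3]; exact h2.trans h1
      have hd : r' - 1 < d := by have := h'.1; omega
      have h1 := step (r' - 1 - r) ⟨r' - 1, hd⟩ (by simp only; omega)
      rw [← le_equalizationLevel_succ_iff hl hσ hm] at h1
      have h2 := h'.2.1 ⟨r' - 1, hd⟩ (by simp only; omega)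
      have h3 : r' - 1 + 1 = r' := by omega
      simp only [h3] at h1
      exact absurd h2 (not_lt.2 h1)
    intro r hr
    have a := key _ _ hr hx
    have b := key _ _ hx hr
    omega

theorem isWaterFillingRank_waterFillingRank {l : Fin d → ℝ} {σ m : ℝ} (hl : ∀ i, 0 < l i)
    (hanti : Antitone l) (hσ : 0 < σ) : IsWaterFillingRank l σ m (waterFillingRank l σ m) := by
  classical
  obtain ⟨r, hr, -⟩ := existsUnique_isWaterFillingRank (m := m) hl hanti hσ
  exact Nat.findGreatest_spec (hr.1.trans (min_le_right _ _)) hr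

end SolicitSuggest

end

open SolicitSuggest

/-!
Let `W` be the water-filling posterior and `S` any feasible one.

*The performance ratio.* Sending every Gaussian vector to its mean shows `D_k(W) ≤ tr W`
(`distortion_le_trace`). Conversely the Shannon lower bound `D_k(S) ≥ d (det S)^(1/d) k^(-2/d)`
(`mul_det_rpow_le_distortion`) follows from Gibbs' inequality: compare the law `𝒩(0, S)` with the
uniform mixture of the `k` Gaussians `𝒩(xⱼ, s)`, whose log-density at `ξ` is at least
`-minⱼ ‖ξ - xⱼ‖² / (2 s)` up to a constant, and optimise over `s`. Since
`tr W = α(W) d (det W)^(1/d)`, the ratio bound reduces to the D-optimality `det W ≤ det S`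
(`det_waterFillingPosterior_le`). Its engine is the supporting hyperplane
`det (A B) ≤ exp (tr (A B) - d)` of the log-determinant (`det_mul_le_exp`). If the rank cap is not
binding, `W ≤ λ • 1` and this with `B = W` suffices. If the rank cap `m < d` is
attained, one compresses the prior to the span of the queries, whose dimension is at
most `m`, replaces the eigenvalues of the compression by the larger `l i`, `i < m`
(`le_of_compression_eq_ofSpectrum`, Cauchy interlacing), and applies the inequality in dimension
`m` (`det_one_add_mul_le`).

*Monotonicity and convexity.* For `m ≥ d` the posterior precisions are `max t pᵢ` with `pᵢ = 1 / lᵢ`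
and a level `t` at which `∑ (max t pᵢ - pᵢ) = m / σ²` (`exists_filling_level`). Seen as a function
of this cost the ratio has derivative
`-d⁻² ∏ (max t pᵢ / t)^(1/d) ∑ (1/t - 1 / max t pᵢ)`, also across the levels `t = pᵢ`, where the
number of queried directions jumps. Both factors are nonnegative and decrease with `t`, so the
derivative is nonpositive and increasing. Right derivatives in `t` turn this into supporting lines
(`fillingRatio_tangent`), from which convexity and monotonicity are immediate. The ratio is `1` as
soon as the budget raises all precisions to the largest one.
-/

open MeasureTheory ProbabilityTheory Matrix
open SolicitSuggest

namespace SolicitSuggest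

/-! ### The log-determinant inequality -/

section Determinant

open scoped MatrixOrder Matrix.Norms.L2Operator

variable {n : Type*} [Fintype n] [DecidableEq n]

/-- The supporting hyperplane `log det X ≤ tr X - n` of the concave log-determinant at the identity,
for `X` similar to a positive semidefinite matrix. -/
theorem det_mul_le_exp {A B : Matrix n n ℝ} (hA : A.PosSemidef) (hB : B.PosSemidef) :
    (A * B).det ≤ Real.exp ((A * B).trace - Fintype.card n) := by
  obtain ⟨C, rfl⟩ := CStarAlgebra.nonneg_iff_eq_star_mul_self.1 hB.nonneg
  rw [star_eq_conjTranspose] at *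
  have h := hA.mul_mul_conjTranspose_same C
  have hdet : (A * (Cᴴ * C)).det = (C * A * Cᴴ).det := by
    simp only [det_mul]; ring
  have htr : (A * (Cᴴ * C)).trace = (C * A * Cᴴ).trace := by
    rw [← Matrix.mul_assoc, trace_mul_comm, ← Matrix.mul_assoc]
  have hdet' := h.1.det_eq_prod_eigenvalues
  have htr' := h.1.trace_eq_sum_eigenvalues
  simp only [RCLike.ofReal_real_eq_id, id_eq] at hdet' htr'
  rw [hdet, htr, hdet', htr', show (∑ i, h.1.eigenvalues i) - (Fintype.card n : ℝ)
    = ∑ i, (h.1.eigenvalues i - 1) by simp, Real.exp_sum]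
  refine Finset.prod_le_prod (fun i _ => h.eigenvalues_nonneg i) fun i _ => ?_
  have := Real.add_one_le_exp (h.1.eigenvalues i - 1)
  linarith

theorem trace_mul_nonneg {A B : Matrix n n ℝ} (hA : A.PosSemidef) (hB : B.PosSemidef) :
    0 ≤ (A * B).trace := by
  obtain ⟨C, rfl⟩ := CStarAlgebra.nonneg_iff_eq_star_mul_self.1 hB.nonneg
  rw [star_eq_conjTranspose] at *
  rw [← Matrix.mul_assoc, trace_mul_comm, ← Matrix.mul_assoc]
  exact (hA.mul_mul_conjTranspose_same C).trace_nonneg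

theorem det_le_det_of_posSemidef_sub {A B : Matrix n n ℝ} (hA : A.PosSemidef) (hB : B.PosDef)
    (h : (B - A).PosSemidef) : A.det ≤ B.det := by
  have h1 := det_mul_le_exp hA hB.inv.posSemidef
  have h2 := trace_mul_nonneg h hB.inv.posSemidef
  have hu : IsUnit B.det := hB.det_pos.ne'.isUnit
  rw [Matrix.sub_mul, trace_sub, mul_nonsing_inv _ hu, trace_one] at h2
  have h3 : (A * B⁻¹).det ≤ 1 := h1.trans (Real.exp_le_one_iff.2 (by linarith))
  rw [det_mul, det_nonsing_inv, Ring.inverse_eq_inv', ← div_eq_mul_inv, div_le_one hB.det_pos] at h3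
  exact h3

end Determinant

/-! ### Symmetric matrices with a given spectral decomposition -/

section Spectrum

variable {n : Type*} [Fintype n] [DecidableEq n]

/-- The symmetric matrix `∑ᵢ cᵢ vᵢ vᵢᵀ` with eigenvalues `c` in the orthonormal basis `v`. -/
noncomputable def ofSpectrum (v : OrthonormalBasis n ℝ (EuclideanSpace ℝ n)) (c : n → ℝ) :
    Matrix n n ℝ :=
  ∑ i, c i • vecMulVec (v i).ofLp (v i).ofLp

/-- The orthogonal matrix whose columns are the vectors of the orthonormal basis `v`. -/
noncomputable def frame (v : OrthonormalBasis n ℝ (EuclideanSpace ℝ n)) : Matrix n n ℝ :=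
  Matrix.of fun i j => v j i

variable (v : OrthonormalBasis n ℝ (EuclideanSpace ℝ n)) (c c' : n → ℝ)

theorem frame_transpose_mul_self : (frame v)ᵀ * frame v = 1 := by
  ext i j
  have := orthonormal_iff_ite.1 v.orthonormal j i
  rw [PiLp.inner_apply] at this
  simp only [mul_apply, transpose_apply, frame, of_apply, one_apply]
  simp only [RCLike.inner_apply, conj_trivial] at this
  rw [this]; simp [eq_comm]

theorem frame_mul_transpose_self : frame v * (frame v)ᵀ = 1 :=
  mul_eq_one_comm.1 (frame_transpose_mul_self v)

theorem ofSpectrum_eq : ofSpectrum v c = frame v * diagonal c * (frame v)ᵀ := by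
  ext i j
  rw [mul_apply]
  simp only [ofSpectrum, Matrix.sum_apply, Matrix.smul_apply, vecMulVec_apply, smul_eq_mul,
    mul_diagonal, transpose_apply, frame, of_apply]
  exact Finset.sum_congr rfl fun k _ => by ring

theorem ofSpectrum_mul : ofSpectrum v c * ofSpectrum v c' = ofSpectrum v (fun i => c i * c' i) := by
  simp only [ofSpectrum_eq]
  calc _ = frame v * diagonal c * ((frame v)ᵀ * frame v) * diagonal c' * (frame v)ᵀ := by
        simp only [Matrix.mul_assoc]
    _ = _ := by
        rw [frame_transpose_mul_self, Matrix.mul_one, Matrix.mul_assoc (frame v), diagonal_mul_diagonal]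

theorem ofSpectrum_one : ofSpectrum v (fun _ => 1) = 1 := by
  rw [ofSpectrum_eq, diagonal_one, Matrix.mul_one, frame_mul_transpose_self]

omit [DecidableEq n] in
theorem ofSpectrum_sub : ofSpectrum v c - ofSpectrum v c' = ofSpectrum v (fun i => c i - c' i) := by
  simp only [ofSpectrum, sub_smul, Finset.sum_sub_distrib]

theorem ofSpectrum_const (a : ℝ) : ofSpectrum v (fun _ => a) = a • (1 : Matrix n n ℝ) := by
  rw [← ofSpectrum_one v]; simp [ofSpectrum, Finset.smul_sum]

theorem trace_ofSpectrum : (ofSpectrum v c).trace = ∑ i, c i := by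
  rw [ofSpectrum_eq, trace_mul_comm, ← Matrix.mul_assoc, frame_transpose_mul_self, Matrix.one_mul,
    trace_diagonal]

theorem det_ofSpectrum : (ofSpectrum v c).det = ∏ i, c i := by
  rw [ofSpectrum_eq, det_mul, mul_comm, ← det_mul, ← Matrix.mul_assoc, frame_transpose_mul_self,
    Matrix.one_mul, det_diagonal]

theorem posSemidef_ofSpectrum {c : n → ℝ} (hc : ∀ i, 0 ≤ c i) : (ofSpectrum v c).PosSemidef := by
  rw [ofSpectrum_eq]
  exact (PosSemidef.diagonal (d := c) hc).mul_mul_conjTranspose_same (frame v)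

theorem posDef_ofSpectrum {c : n → ℝ} (hc : ∀ i, 0 < c i) : (ofSpectrum v c).PosDef := by
  rw [(posSemidef_ofSpectrum v fun i => (hc i).le).posDef_iff_det_ne_zero, det_ofSpectrum]
  exact (Finset.prod_pos fun i _ => hc i).ne'

theorem ofSpectrum_inv {c : n → ℝ} (hc : ∀ i, c i ≠ 0) :
    (ofSpectrum v c)⁻¹ = ofSpectrum v (fun i => (c i)⁻¹) := by
  apply inv_eq_right_inv
  rw [ofSpectrum_mul, ← ofSpectrum_one v]
  congr 1; ext i; exact mul_inv_cancel₀ (hc i)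

omit [DecidableEq n] in
theorem dotProduct_ofSpectrum_mulVec (x : EuclideanSpace ℝ n) :
    x.ofLp ⬝ᵥ ofSpectrum v c *ᵥ x.ofLp = ∑ i, c i * inner ℝ (v i) x ^ 2 := by
  simp only [ofSpectrum, sum_mulVec, smul_mulVec, vecMulVec_mulVec, dotProduct_sum]
  refine Finset.sum_congr rfl fun i _ => ?_
  have : inner ℝ (v i) x = (v i).ofLp ⬝ᵥ x.ofLp := by
    rw [EuclideanSpace.inner_eq_star_dotProduct, dotProduct_comm]; simp
  rw [this]
  simp only [dotProduct_smul, smul_eq_mul, op_smul_eq_smul]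
  rw [dotProduct_comm x.ofLp]; ring

theorem posDef_ofSpectrum_iff : (ofSpectrum v c).PosDef ↔ ∀ i, 0 < c i := by
  refine ⟨fun h i => ?_, posDef_ofSpectrum v⟩
  have h1 := h.dotProduct_mulVec_pos (x := (v i).ofLp) fun h0 =>
    v.orthonormal.ne_zero i (by ext j; simp [h0])
  rw [star_trivial, dotProduct_ofSpectrum_mulVec] at h1
  simpa [orthonormal_iff_ite.1 v.orthonormal] using h1

theorem exists_eq_ofSpectrum {M : Matrix n n ℝ} (hM : M.IsHermitian) :
    M = ofSpectrum hM.eigenvectorBasis hM.eigenvalues := by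
  conv_lhs => rw [hM.spectral_theorem]
  rw [ofSpectrum_eq]
  rfl

/-- A real symmetric matrix has a spectral decomposition with decreasing eigenvalues. -/
theorem exists_eq_ofSpectrum_antitone {m : ℕ} {M : Matrix (Fin m) (Fin m) ℝ} (hM : M.IsHermitian) :
    ∃ (u : OrthonormalBasis (Fin m) ℝ (EuclideanSpace ℝ (Fin m))) (a : Fin m → ℝ),
      Antitone a ∧ M = ofSpectrum u a := by
  let s := Tuple.sort fun i => -hM.eigenvalues i
  refine ⟨hM.eigenvectorBasis.reindex s.symm, fun i => hM.eigenvalues (s i), fun i j hij => ?_, ?_⟩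
  · have := Tuple.monotone_sort (fun i => -hM.eigenvalues i) hij
    simpa [s] using this
  · conv_lhs => rw [exists_eq_ofSpectrum hM]
    simp only [ofSpectrum, OrthonormalBasis.reindex_apply, Equiv.symm_symm]
    exact (Equiv.sum_comp s fun i => hM.eigenvalues i •
      vecMulVec (hM.eigenvectorBasis i).ofLp (hM.eigenvectorBasis i).ofLp).symm

end Spectrum

/-! ### Compressions and perturbations of bounded rank -/

/-- One half of Cauchy's interlacing theorem: the eigenvalues of the compression `Qᵀ S Q` of a
symmetric matrix `S` to an `m`-dimensional subspace are dominated by the `m` largest eigenvalues of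
`S`. -/
theorem le_of_compression_eq_ofSpectrum {d m : ℕ} (hmd : m ≤ d)
    (v : OrthonormalBasis (Fin d) ℝ (EuclideanSpace ℝ (Fin d))) {l : Fin d → ℝ} (hl : Antitone l)
    (u : OrthonormalBasis (Fin m) ℝ (EuclideanSpace ℝ (Fin m))) {a : Fin m → ℝ} (ha : Antitone a)
    {Q : Matrix (Fin d) (Fin m) ℝ} (hQ : Qᵀ * Q = 1)
    (h : Qᵀ * ofSpectrum v l * Q = ofSpectrum u a) (i : Fin m) : a i ≤ l (Fin.castLE hmd i) := by
  -- A vector `y` of the span of `u 0, …, u i` with `Q y` orthogonal to `v 0, …, v (i - 1)` exists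
  -- since these are `m - 1` linear conditions; they are encoded as a non-surjective endomorphism.
  let L : EuclideanSpace ℝ (Fin m) →ₗ[ℝ] (Fin m → ℝ) :=
    { toFun := fun y k => if k < i then inner ℝ (v (Fin.castLE hmd k)) (WithLp.toLp 2 (Q *ᵥ y.ofLp))
        else if i < k then inner ℝ (u k) y else 0
      map_add' := fun y z => by
        ext k
        simp only [WithLp.ofLp_add, mulVec_add, WithLp.toLp_add, inner_add_right, Pi.add_apply]
        split_ifs <;> simp
      map_smul' := fun c y => by
        ext k
        simp only [WithLp.ofLp_smul, mulVec_smul, WithLp.toLp_smul, inner_smul_right, Pi.smul_apply,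
          RingHom.id_apply, smul_eq_mul]
        split_ifs <;> simp }
  have hL : LinearMap.ker L ≠ ⊥ := by
    intro hker
    rw [LinearMap.ker_eq_bot,
      LinearMap.injective_iff_surjective_of_finrank_eq_finrank (by simp)] at hker
    obtain ⟨y, hy⟩ := hker (fun _ => 1)
    have := congrFun hy i
    simp [L] at this
  obtain ⟨y, hy, hy0⟩ := Submodule.exists_mem_ne_zero_of_ne_bot hL
  have hLy : ∀ k, L y k = 0 := fun k => congrFun (LinearMap.mem_ker.1 hy) k
  set x : EuclideanSpace ℝ (Fin d) := WithLp.toLp 2 (Q *ᵥ y.ofLp) with hx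
  have hv : ∀ k : Fin d, k < Fin.castLE hmd i → inner ℝ (v k) x = 0 := by
    intro k hk
    have hkm : k.val < m := (Fin.lt_def.1 hk).trans i.2
    have hki : (⟨k, hkm⟩ : Fin m) < i := Fin.lt_def.2 (Fin.lt_def.1 hk)
    have := hLy ⟨k, hkm⟩
    simpa [L, hki] using this
  have hu : ∀ k : Fin m, i < k → inner ℝ (u k) y = 0 := by
    intro k hk
    have := hLy k
    simpa [L, hk, hk.not_gt] using this
  have hnorm : ‖x‖ ^ 2 = ‖y‖ ^ 2 := by
    rw [EuclideanSpace.real_norm_sq_eq, EuclideanSpace.real_norm_sq_eq]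
    have e1 : ∑ j, x.ofLp j ^ 2 = x.ofLp ⬝ᵥ x.ofLp := by simp [dotProduct, sq]
    have e2 : ∑ j, y.ofLp j ^ 2 = y.ofLp ⬝ᵥ y.ofLp := by simp [dotProduct, sq]
    rw [e1, e2, hx]
    simp only
    rw [dotProduct_mulVec, vecMul_mulVec, hQ, vecMul_one]
  have hquad : y.ofLp ⬝ᵥ ofSpectrum u a *ᵥ y.ofLp = x.ofLp ⬝ᵥ ofSpectrum v l *ᵥ x.ofLp := by
    rw [← h, hx]
    simp only
    rw [← mulVec_mulVec, ← mulVec_mulVec, dotProduct_mulVec y.ofLp, vecMul_transpose]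
  rw [dotProduct_ofSpectrum_mulVec, dotProduct_ofSpectrum_mulVec] at hquad
  have h1 : a i * ‖y‖ ^ 2 ≤ ∑ k, a k * inner ℝ (u k) y ^ 2 := by
    rw [← u.sum_sq_inner_right, Finset.mul_sum]
    refine Finset.sum_le_sum fun k _ => ?_
    rcases lt_or_ge i k with hk | hk
    · simp [hu k hk]
    · exact mul_le_mul_of_nonneg_right (ha hk) (sq_nonneg _)
  have h2 : ∑ k, l k * inner ℝ (v k) x ^ 2 ≤ l (Fin.castLE hmd i) * ‖x‖ ^ 2 := by
    rw [← v.sum_sq_inner_right, Finset.mul_sum]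
    refine Finset.sum_le_sum fun k _ => ?_
    rcases lt_or_ge k (Fin.castLE hmd i) with hk | hk
    · simp [hv k hk]
    · exact mul_le_mul_of_nonneg_right (hl hk) (sq_nonneg _)
  rw [hnorm] at h2
  have hpos : 0 < ‖y‖ ^ 2 := by positivity
  exact le_of_mul_le_mul_right (h1.trans (hquad.le.trans h2)) hpos

/-- A thin QR decomposition: the columns of a tall matrix lie in the span of an orthonormal family
of the same length. -/
theorem exists_eq_mul_of_le {d m : ℕ} (hmd : m ≤ d) (Y : Matrix (Fin d) (Fin m) ℝ) :
    ∃ (Q : Matrix (Fin d) (Fin m) ℝ) (B : Matrix (Fin m) (Fin m) ℝ), Qᵀ * Q = 1 ∧ Y = Q * B := by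
  let f : Fin d → EuclideanSpace ℝ (Fin d) := fun j =>
    if hj : j.val < m then WithLp.toLp 2 (fun i => Y i ⟨j, hj⟩) else 0
  let q := InnerProductSpace.gramSchmidtOrthonormalBasis (𝕜 := ℝ) (by simp) f
  have hq : (frame q)ᵀ * frame q = 1 := frame_transpose_mul_self q
  let Q : Matrix (Fin d) (Fin m) ℝ := (frame q).submatrix id (Fin.castLE hmd)
  refine ⟨Q, Qᵀ * Y, ?_, ?_⟩
  · ext i j
    have := congrFun (congrFun hq (Fin.castLE hmd i)) (Fin.castLE hmd j)
    simpa [Q, mul_apply, one_apply, (Fin.castLE_injective hmd).eq_iff] using this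
  · ext i t
    have hexp := q.sum_repr' (f (Fin.castLE hmd t))
    have hf : f (Fin.castLE hmd t) = WithLp.toLp 2 (fun i => Y i t) := by simp [f]
    have hi := congrArg (fun z : EuclideanSpace ℝ (Fin d) => z.ofLp i) hexp
    have h0 : ∀ j : Fin d, m ≤ j.val → inner ℝ (q j) (f (Fin.castLE hmd t)) = 0 := fun j hj =>
      InnerProductSpace.gramSchmidtOrthonormalBasis_inv_triangular (𝕜 := ℝ) (by simp) f
        (Fin.lt_def.2 (t.2.trans_le hj))
    have hsum : ∑ j, inner ℝ (q j) (f (Fin.castLE hmd t)) * (q j).ofLp i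
        = ∑ s : Fin m, inner ℝ (q (Fin.castLE hmd s)) (f (Fin.castLE hmd t)) *
          (q (Fin.castLE hmd s)).ofLp i := by
      symm
      refine Finset.sum_of_injOn (Fin.castLE hmd) (Fin.castLE_injective hmd).injOn (by simp) ?_
        (fun _ _ => rfl)
      intro j _ hj
      rw [h0 j, zero_mul]
      by_contra hjm
      exact hj ⟨⟨j, by omega⟩, by simp, rfl⟩
    simp only [WithLp.ofLp_sum, WithLp.ofLp_smul, Finset.sum_apply, Pi.smul_apply, smul_eq_mul] at hi
    rw [hsum, hf] at hi
    simp only [mul_apply, Q, transpose_apply, submatrix_apply, frame, of_apply, id_eq]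
    refine hi.symm.trans ?_
    refine Finset.sum_congr rfl fun s _ => ?_
    rw [mul_comm, PiLp.inner_apply]
    simp [mul_comm]

/-- If `W = Y Yᵀ` has rank at most `m`, only the `m` largest eigenvalues of `S` matter in
`det (1 + W S)`, and for these the maximum under a trace constraint on `W` is attained by spreading
the budget evenly. -/
theorem det_one_add_mul_le {d m : ℕ} (hmd : m ≤ d)
    (v : OrthonormalBasis (Fin d) ℝ (EuclideanSpace ℝ (Fin d))) {l : Fin d → ℝ} (hl : Antitone l)
    (hpos : ∀ i, 0 < l i) (Y : Matrix (Fin d) (Fin m) ℝ) {c : ℝ} (hc : 0 < c) :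
    (1 + Y * Yᵀ * ofSpectrum v l).det ≤
      (∏ i : Fin m, l (Fin.castLE hmd i)) *
        ((c⁻¹) ^ m * Real.exp (c * ((∑ i : Fin m, (l (Fin.castLE hmd i))⁻¹) + (Y * Yᵀ).trace) - m)) := by
  obtain ⟨Q, B, hQ, rfl⟩ := exists_eq_mul_of_le hmd Y
  set S := ofSpectrum v l
  have hS : S.PosDef := posDef_ofSpectrum v hpos
  set M := Qᵀ * S * Q
  have hM : M.PosSemidef := hS.posSemidef.conjTranspose_mul_mul_same Q
  obtain ⟨u, a, ha, hMu⟩ := exists_eq_ofSpectrum_antitone hM.1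
  let b : Fin m → ℝ := fun i => l (Fin.castLE hmd i)
  have hb : ∀ i, 0 < b i := fun i => hpos _
  have hab : ∀ i, a i ≤ b i := le_of_compression_eq_ofSpectrum hmd v hl u ha hQ hMu
  set M' := ofSpectrum u b
  have hM' : M'.PosDef := posDef_ofSpectrum u hb
  have hMM' : (M' - M).PosSemidef := by
    rw [hMu, ofSpectrum_sub]
    exact posSemidef_ofSpectrum u fun i => sub_nonneg.2 (hab i)
  have e1 : (1 + Q * B * (Q * B)ᵀ * S).det = (1 + Bᵀ * M * B).det := by
    rw [Matrix.mul_assoc, det_one_add_mul_comm]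
    congr 2
    simp only [M, transpose_mul, Matrix.mul_assoc]
  have e2 : (1 + Bᵀ * M * B).det ≤ (1 + Bᵀ * M' * B).det := by
    apply det_le_det_of_posSemidef_sub
    · exact PosSemidef.one.add (hM.conjTranspose_mul_mul_same B)
    · exact PosDef.one.add_posSemidef (hM'.posSemidef.conjTranspose_mul_mul_same B)
    · have : 1 + Bᵀ * M' * B - (1 + Bᵀ * M * B) = Bᵀ * (M' - M) * B := by
        rw [Matrix.mul_sub, Matrix.sub_mul]; abel
      rw [this]
      exact hMM'.conjTranspose_mul_mul_same B
  have e3 : (1 + Bᵀ * M' * B).det = M'.det * (M'⁻¹ + B * Bᵀ).det := by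
    rw [Matrix.mul_assoc, det_one_add_mul_comm, ← det_mul, Matrix.mul_add,
      mul_nonsing_inv _ hM'.det_pos.ne'.isUnit, Matrix.mul_assoc]
  have e4 := det_mul_le_exp (A := M'⁻¹ + B * Bᵀ) (B := c • (1 : Matrix (Fin m) (Fin m) ℝ))
    (hM'.inv.posSemidef.add (posSemidef_self_mul_conjTranspose B)) (PosSemidef.one.smul hc.le)
  have e5 : (B * Bᵀ).trace = (Q * B * (Q * B)ᵀ).trace := by
    rw [trace_mul_comm, trace_mul_comm (Q * B), transpose_mul]
    congr 1
    rw [Matrix.mul_assoc, ← Matrix.mul_assoc Qᵀ, hQ, Matrix.one_mul]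
  have e6 : M'⁻¹.trace = ∑ i, (b i)⁻¹ := by
    rw [ofSpectrum_inv u fun i => (hb i).ne', trace_ofSpectrum]
  rw [det_mul, det_smul, det_one, mul_one, Matrix.mul_smul, Matrix.mul_one, trace_smul, trace_add, e5,
    e6, Fintype.card_fin, smul_eq_mul] at e4
  rw [e1]
  refine e2.trans ?_
  rw [e3, det_ofSpectrum]
  refine mul_le_mul_of_nonneg_left ?_ (Finset.prod_nonneg fun i _ => (hb i).le)
  rw [inv_pow, inv_mul_eq_div, le_div_iff₀ (by positivity)]
  exact e4

/-! ### D-optimality of water-filling -/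

variable {d : ℕ}

/-- The eigenvalues of the water-filling posterior in the eigenbasis of the prior covariance. -/
noncomputable def waterFillingEigenvalue (l : Fin d → ℝ) (σ m : ℝ) (i : Fin d) : ℝ :=
  if i.val < waterFillingRank l σ m then equalizationLevel l σ m (waterFillingRank l σ m) else l i

theorem waterFillingPosterior_eq (v : OrthonormalBasis (Fin d) ℝ (EuclideanSpace ℝ (Fin d)))
    (l : Fin d → ℝ) (σ m : ℝ) :
    waterFillingPosterior v l σ m = ofSpectrum v (waterFillingEigenvalue l σ m) := rfl

section Rank

variable {l : Fin d → ℝ} {σ m : ℝ} {r : ℕ}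

theorem equalizationLevel_denom_pos (hl : ∀ i, 0 < l i) (hσ : 0 < σ)
    (hr : IsWaterFillingRank l σ m r) (hr0 : 0 < r) :
    0 < (∑ i with i.val < r, (l i)⁻¹) + m / σ ^ 2 := by
  have hm : 0 < m := by
    have h : 0 < ⌊m⌋₊ := by have := hr.1; omega
    exact zero_lt_one.trans_le (Nat.floor_pos.1 h)
  have : 0 ≤ ∑ i with i.val < r, (l i)⁻¹ := Finset.sum_nonneg fun i _ => (inv_pos.2 (hl i)).le
  positivity

theorem equalizationLevel_pos (hl : ∀ i, 0 < l i) (hσ : 0 < σ)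
    (hr : IsWaterFillingRank l σ m r) (hr0 : 0 < r) : 0 < equalizationLevel l σ m r :=
  div_pos (by exact_mod_cast hr0) (equalizationLevel_denom_pos hl hσ hr hr0)

theorem equalizationLevel_mul (hl : ∀ i, 0 < l i) (hσ : 0 < σ)
    (hr : IsWaterFillingRank l σ m r) (hr0 : 0 < r) :
    equalizationLevel l σ m r * ((∑ i with i.val < r, (l i)⁻¹) + m / σ ^ 2) = r :=
  div_mul_cancel₀ _ (equalizationLevel_denom_pos hl hσ hr hr0).ne'

theorem equalizationLevel_lt (hanti : Antitone l) (hr : IsWaterFillingRank l σ m r) {i : Fin d}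
    (hi : i.val < r) : equalizationLevel l σ m r < l i := by
  have hrd := hr.1
  have h := hr.2.1 ⟨r - 1, by omega⟩ (by simp only; omega)
  exact h.trans_le (hanti (Fin.le_def.2 (by simp only; omega)))

/-- Below the cap at least one direction is queried, as the level of rank `0` is `0`. -/
theorem rank_pos_of_lt (hl : ∀ i, 0 < l i) (hr : IsWaterFillingRank l σ m r)
    (hlt : r < min ⌊m⌋₊ d) : 0 < r := by
  rcases Nat.eq_zero_or_pos r with rfl | h
  · have h1 := hr.2.2 hlt ⟨0, by omega⟩ rfl
    simp only [equalizationLevel, Nat.cast_zero, zero_div] at h1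
    exact absurd h1 (not_le.2 (hl _))
  · exact h

theorem le_equalizationLevel (hanti : Antitone l) (hr : IsWaterFillingRank l σ m r)
    (hlt : r < min ⌊m⌋₊ d) {i : Fin d} (hi : r ≤ i.val) : l i ≤ equalizationLevel l σ m r :=
  (hanti (Fin.le_def.2 hi)).trans (hr.2.2 hlt ⟨r, by omega⟩ rfl)

variable (hl : ∀ i, 0 < l i) (hanti : Antitone l) (hσ : 0 < σ)
include hl hanti hσ

theorem waterFillingEigenvalue_pos (i : Fin d) : 0 < waterFillingEigenvalue l σ m i := by
  have hr := isWaterFillingRank_waterFillingRank (m := m) hl hanti hσ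
  unfold waterFillingEigenvalue
  split_ifs with h
  · exact equalizationLevel_pos hl hσ hr (by omega)
  · exact hl i

/-- As long as the rank cap is not binding, water-filling truncates the prior eigenvalues at the
common level. -/
theorem waterFillingEigenvalue_eq_min
    (h : waterFillingRank l σ m < min ⌊m⌋₊ d ∨ waterFillingRank l σ m = d) (i : Fin d) :
    waterFillingEigenvalue l σ m i = min (equalizationLevel l σ m (waterFillingRank l σ m)) (l i) := by
  have hr := isWaterFillingRank_waterFillingRank (m := m) hl hanti hσ
  unfold waterFillingEigenvalue
  split_ifs with hi
  · exact (min_eq_left (equalizationLevel_lt hanti hr hi).le).symm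
  · rcases h with h | h
    · exact (min_eq_right (le_equalizationLevel hanti hr h (not_lt.1 hi))).symm
    · omega

end Rank

theorem card_filter_val_lt {r : ℕ} (hr : r ≤ d) :
    (Finset.univ.filter fun i : Fin d => i.val < r).card = r := by
  rw [Fin.card_filter_val_lt, min_eq_right hr]

theorem prod_castLE {m : ℕ} (hmd : m ≤ d) (f : Fin d → ℝ) :
    ∏ i : Fin m, f (Fin.castLE hmd i) = ∏ i with i.val < m, f i :=
  Finset.prod_nbij (Fin.castLE hmd) (by simp) (Fin.castLE_injective hmd).injOn
    (fun j hj => ⟨⟨j, by simpa using hj⟩, by simp, rfl⟩) fun _ _ => rfl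

theorem sum_castLE {m : ℕ} (hmd : m ≤ d) (f : Fin d → ℝ) :
    ∑ i : Fin m, f (Fin.castLE hmd i) = ∑ i with i.val < m, f i :=
  Finset.sum_nbij (Fin.castLE hmd) (by simp) (Fin.castLE_injective hmd).injOn
    (fun j hj => ⟨⟨j, by simpa using hj⟩, by simp, rfl⟩) fun _ _ => rfl

/-- The matrix with columns `yₜ / σ`. -/
noncomputable def queryMatrix (σ : ℝ) {m : ℕ} (y : Fin m → EuclideanSpace ℝ (Fin d)) :
    Matrix (Fin d) (Fin m) ℝ :=
  Matrix.of fun i t => (y t).ofLp i / σ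

theorem queryMatrix_mul_transpose (σ : ℝ) {m : ℕ} (y : Fin m → EuclideanSpace ℝ (Fin d)) :
    queryMatrix σ y * (queryMatrix σ y)ᵀ
      = (1 / σ ^ 2) • ∑ t, vecMulVec (y t).ofLp (y t).ofLp := by
  ext i j
  rw [mul_apply, Matrix.smul_apply, Matrix.sum_apply, smul_eq_mul, Finset.mul_sum]
  simp only [queryMatrix, of_apply, transpose_apply, vecMulVec_apply]
  exact Finset.sum_congr rfl fun t _ => by ring

theorem trace_queryMatrix_mul_transpose (σ : ℝ) {m : ℕ} {y : Fin m → EuclideanSpace ℝ (Fin d)}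
    (hy : ∀ t, ‖y t‖ = 1) : (queryMatrix σ y * (queryMatrix σ y)ᵀ).trace = m / σ ^ 2 := by
  have h : ∀ t, (vecMulVec (y t).ofLp (y t).ofLp).trace = 1 := fun t => by
    rw [trace_vecMulVec, ← one_pow 2, ← hy t, EuclideanSpace.real_norm_sq_eq]
    simp [dotProduct, sq]
  rw [queryMatrix_mul_transpose, trace_smul, trace_sum]
  simp [h, div_eq_inv_mul]

theorem IsFeasiblePosterior.exists_eq {S₀ S : Matrix (Fin d) (Fin d) ℝ} {σ : ℝ} {m : ℕ}
    (h : IsFeasiblePosterior S₀ σ m S) :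
    ∃ Y : Matrix (Fin d) (Fin m) ℝ, (Y * Yᵀ).trace = m / σ ^ 2 ∧ S = (S₀⁻¹ + Y * Yᵀ)⁻¹ := by
  obtain ⟨y, hy, rfl⟩ := h
  refine ⟨queryMatrix σ y, trace_queryMatrix_mul_transpose σ hy, ?_⟩
  rw [queryMatrix_mul_transpose, posteriorCov]

theorem IsFeasiblePosterior.posDef {S₀ S : Matrix (Fin d) (Fin d) ℝ} (hS₀ : S₀.PosDef) {σ : ℝ}
    {m : ℕ} (h : IsFeasiblePosterior S₀ σ m S) : S.PosDef := by
  obtain ⟨Y, -, rfl⟩ := h.exists_eq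
  exact (hS₀.inv.add_posSemidef (posSemidef_self_mul_conjTranspose Y)).inv

section Optimality

variable (v : OrthonormalBasis (Fin d) ℝ (EuclideanSpace ℝ (Fin d))) {l : Fin d → ℝ} {σ : ℝ} {m : ℕ}

/-- If the rank cap is not binding, the water-filling posterior is at most `λ • 1`, so its
log-determinant is supported by a linear functional that no feasible precision can exceed. -/
theorem det_mul_waterFilling_le_one_of_not_capped (hl : ∀ i, 0 < l i) (hanti : Antitone l)
    (hσ : 0 < σ)
    (h : waterFillingRank l σ m < min ⌊(m : ℝ)⌋₊ d ∨ waterFillingRank l σ m = d) (hd : 0 < d)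
    {Y : Matrix (Fin d) (Fin m) ℝ} (hY : (Y * Yᵀ).trace = m / σ ^ 2) :
    (((ofSpectrum v l)⁻¹ + Y * Yᵀ) * waterFillingPosterior v l σ m).det ≤ 1 := by
  have hr := isWaterFillingRank_waterFillingRank (m := m) hl hanti hσ
  have hmin := waterFillingEigenvalue_eq_min hl hanti hσ h
  have hpos := waterFillingEigenvalue_pos (m := m) hl hanti hσ
  have hr0 : 0 < waterFillingRank l σ m := by
    rcases h with h | h
    · exact rank_pos_of_lt hl hr h
    · omega
  have hlev := equalizationLevel_mul hl hσ hr hr0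
  have hrd : waterFillingRank l σ m ≤ d := hr.1.trans (min_le_right _ _)
  rw [waterFillingPosterior_eq]
  set w := waterFillingEigenvalue l σ m with hw
  set r := waterFillingRank l σ m
  set c := equalizationLevel l σ m r
  refine (det_mul_le_exp ((posDef_ofSpectrum v hl).inv.posSemidef.add
    (posSemidef_self_mul_conjTranspose Y)) (posSemidef_ofSpectrum v fun i => (hpos i).le)).trans ?_
  rw [Real.exp_le_one_iff, Fintype.card_fin, sub_nonpos, conjTranspose_eq_transpose_of_trivial,
    Matrix.add_mul, trace_add, ofSpectrum_inv v fun i => (hl i).ne', ofSpectrum_mul,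
    trace_ofSpectrum]
  have h1 : (Y * Yᵀ * ofSpectrum v w).trace ≤ c * (m / σ ^ 2) := by
    have := trace_mul_nonneg (posSemidef_self_mul_conjTranspose Y)
      (posSemidef_ofSpectrum v (c := fun i => c - w i) fun i =>
        sub_nonneg.2 ((hmin i).le.trans (min_le_left _ _)))
    rw [← ofSpectrum_sub v (fun _ => c), ofSpectrum_const, Matrix.mul_sub, trace_sub,
      Matrix.mul_smul, Matrix.mul_one, trace_smul, conjTranspose_eq_transpose_of_trivial, hY,
      smul_eq_mul] at this
    linarith
  have h2 : ∑ i, (l i)⁻¹ * w i = c * (∑ i with i.val < r, (l i)⁻¹) + (d - r) := by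
    have : ∀ i, (l i)⁻¹ * w i = if i.val < r then c * (l i)⁻¹ else 1 := fun i => by
      simp only [hw, waterFillingEigenvalue]
      split_ifs
      · exact mul_comm _ _
      · exact inv_mul_cancel₀ (hl i).ne'
    simp_rw [this]
    rw [Finset.sum_ite, Finset.mul_sum, Finset.sum_const, Finset.filter_not,
      Finset.card_sdiff_of_subset (Finset.filter_subset _ _), card_filter_val_lt hrd]
    simp [Nat.cast_sub hrd]
  rw [h2]
  linarith

/-- If the rank cap `m ≤ d` is attained, the queries span at most as many directions as water-filling
raises, and the bound comes from `det_one_add_mul_le`. -/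
theorem det_mul_waterFilling_le_one_of_capped (hl : ∀ i, 0 < l i) (hanti : Antitone l)
    (hσ : 0 < σ) (hmd : m ≤ d) (h : waterFillingRank l σ m = m)
    {Y : Matrix (Fin d) (Fin m) ℝ} (hY : (Y * Yᵀ).trace = m / σ ^ 2) :
    (((ofSpectrum v l)⁻¹ + Y * Yᵀ) * waterFillingPosterior v l σ m).det ≤ 1 := by
  have hr := isWaterFillingRank_waterFillingRank (m := m) hl hanti hσ
  rw [h] at hr
  -- For `m = 0` the level is zero and occurs nowhere; any positive number can take its place.
  obtain ⟨c, hc, hcm, hcw⟩ : ∃ c, 0 < c ∧ c * ((∑ i with i.val < m, (l i)⁻¹) + m / σ ^ 2) = m ∧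
      ∏ i, waterFillingEigenvalue l σ m i = c ^ m * ∏ i with ¬ i.val < m, l i := by
    rcases Nat.eq_zero_or_pos m with hm | hm
    · refine ⟨1, one_pos, by simp [hm], ?_⟩
      simp only [waterFillingEigenvalue, h]
      simp [hm]
    · refine ⟨equalizationLevel l σ m m, equalizationLevel_pos hl hσ hr hm,
        equalizationLevel_mul hl hσ hr hm, ?_⟩
      simp only [waterFillingEigenvalue, h]
      rw [Finset.prod_ite, Finset.prod_const, card_filter_val_lt hmd]
  have key := det_one_add_mul_le hmd v hanti hl Y hc
  rw [prod_castLE hmd l, sum_castLE hmd fun i => (l i)⁻¹, hY, hcm, sub_self, Real.exp_zero,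
    mul_one] at key
  have hS : (ofSpectrum v l).PosDef := posDef_ofSpectrum v hl
  have e : 1 + Y * Yᵀ * ofSpectrum v l = ((ofSpectrum v l)⁻¹ + Y * Yᵀ) * ofSpectrum v l := by
    rw [Matrix.add_mul, nonsing_inv_mul _ hS.det_pos.ne'.isUnit]
  rw [e, det_mul, det_ofSpectrum, ← Finset.prod_filter_mul_prod_filter_not Finset.univ
    (fun i : Fin d => i.val < m)] at key
  rw [det_mul, waterFillingPosterior_eq, det_ofSpectrum, hcw]
  have hA : 0 < ∏ i with i.val < m, l i := Finset.prod_pos fun i _ => hl i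
  set A := ∏ i with i.val < m, l i
  set B := ∏ i with ¬ i.val < m, l i
  have h1 : A * (((ofSpectrum v l)⁻¹ + Y * Yᵀ).det * (c ^ m * B)) ≤ A * 1 := by
    calc _ = (((ofSpectrum v l)⁻¹ + Y * Yᵀ).det * (A * B)) * c ^ m := by ring
      _ ≤ (A * (c⁻¹) ^ m) * c ^ m := by gcongr
      _ = A * 1 := by rw [inv_pow, mul_assoc, inv_mul_cancel₀ (pow_ne_zero _ hc.ne')]
  exact le_of_mul_le_mul_left h1 hA

/-- Water-filling is D-optimal: it minimises the determinant among the feasible posteriors. -/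
theorem det_waterFillingPosterior_le (hl : ∀ i, 0 < l i) (hanti : Antitone l) (hσ : 0 < σ)
    (hd : 0 < d) {S : Matrix (Fin d) (Fin d) ℝ} (hS : IsFeasiblePosterior (ofSpectrum v l) σ m S) :
    (waterFillingPosterior v l σ m).det ≤ S.det := by
  obtain ⟨Y, hY, rfl⟩ := hS.exists_eq
  have hr := (isWaterFillingRank_waterFillingRank (m := m) hl hanti hσ).1
  have hP : 0 < ((ofSpectrum v l)⁻¹ + Y * Yᵀ).det :=
    ((posDef_ofSpectrum v hl).inv.add_posSemidef (posSemidef_self_mul_conjTranspose Y)).det_pos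
  have key : (((ofSpectrum v l)⁻¹ + Y * Yᵀ) * waterFillingPosterior v l σ m).det ≤ 1 := by
    by_cases h : waterFillingRank l σ m < min ⌊(m : ℝ)⌋₊ d ∨ waterFillingRank l σ m = d
    · exact det_mul_waterFilling_le_one_of_not_capped v hl hanti hσ h hd hY
    · rw [Nat.floor_natCast] at h hr
      exact det_mul_waterFilling_le_one_of_capped v hl hanti hσ (by omega) (by omega) hY
  rw [det_mul] at key
  rw [det_nonsing_inv, Ring.inverse_eq_inv', inv_eq_one_div, le_div_iff₀ hP, mul_comm]
  exact key

end Optimality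

/-! ### The Shannon lower bound for Gaussian quantization -/

section GaussianDensity

variable {E : Type*} [NormedAddCommGroup E] [InnerProductSpace ℝ E] [FiniteDimensional ℝ E]
  [MeasurableSpace E] [BorelSpace E]

/-- The Lebesgue density of the standard Gaussian measure. -/
noncomputable def stdGaussianDensity (x : E) : ℝ :=
  ((2 * Real.pi) ^ (Module.finrank ℝ E / 2 : ℝ))⁻¹ * Real.exp (-‖x‖ ^ 2 / 2)

omit [FiniteDimensional ℝ E] [MeasurableSpace E] [BorelSpace E] in
theorem stdGaussianDensity_nonneg (x : E) : 0 ≤ stdGaussianDensity x := by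
  unfold stdGaussianDensity; positivity

omit [FiniteDimensional ℝ E] [MeasurableSpace E] [BorelSpace E] in
theorem continuous_stdGaussianDensity : Continuous (stdGaussianDensity : E → ℝ) := by
  unfold stdGaussianDensity; fun_prop

theorem integrable_exp_neg_mul_sq_norm {b : ℝ} (hb : 0 < b) :
    Integrable fun x : E => Real.exp (-b * ‖x‖ ^ 2) := by
  apply Integrable.of_integral_ne_zero
  rw [GaussianFourier.integral_rexp_neg_mul_sq_norm hb]
  positivity

theorem integrable_stdGaussianDensity : Integrable (stdGaussianDensity : E → ℝ) := by
  have := (integrable_exp_neg_mul_sq_norm (E := E) (b := 1 / 2) (by norm_num)).const_mul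
    ((2 * Real.pi) ^ (Module.finrank ℝ E / 2 : ℝ))⁻¹
  convert this using 2 with x
  unfold stdGaussianDensity
  congr 2; ring

theorem stdGaussian_eq_withDensity :
    stdGaussian E = volume.withDensity fun x => ENNReal.ofReal (stdGaussianDensity x) := by
  have := isFiniteMeasure_withDensity_ofReal (integrable_stdGaussianDensity (E := E)).2
  refine Measure.ext_of_charFun ?_
  ext t
  rw [charFun_stdGaussian, charFun_apply, integral_withDensity_eq_integral_toReal_smul
    continuous_stdGaussianDensity.measurable.ennreal_ofReal (by simp)]
  have h := GaussianFourier.integral_cexp_neg_mul_sq_norm_add (V := E) (b := 1 / 2) (by norm_num)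
    Complex.I t
  have e : ∀ x : E, (ENNReal.ofReal (stdGaussianDensity x)).toReal •
      Complex.exp (inner ℝ x t * Complex.I)
      = (((2 * Real.pi) ^ (Module.finrank ℝ E / 2 : ℝ) : ℝ) : ℂ)⁻¹ *
        Complex.exp (-(1 / 2) * ‖x‖ ^ 2 + Complex.I * inner ℝ t x) := fun x => by
    rw [ENNReal.toReal_ofReal (stdGaussianDensity_nonneg x), Complex.real_smul, stdGaussianDensity,
      Complex.ofReal_mul, Complex.ofReal_inv, Complex.ofReal_exp, mul_assoc, ← Complex.exp_add,
      real_inner_comm]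
    congr 2
    push_cast
    ring
  simp_rw [e]
  rw [integral_const_mul, h, ← mul_assoc, Complex.ofReal_cpow (by positivity)]
  have hpi : (((2 * Real.pi : ℝ) : ℂ)) ^ (((Module.finrank ℝ E / 2 : ℝ)) : ℂ) ≠ 0 := by
    rw [← Complex.ofReal_cpow (by positivity)]
    exact_mod_cast (by positivity : (2 * Real.pi) ^ (Module.finrank ℝ E / 2 : ℝ) ≠ 0)
  have h2 : (Real.pi / (1 / 2) : ℂ) ^ (Module.finrank ℝ E / 2 : ℂ)
      = (((2 * Real.pi : ℝ) : ℂ)) ^ (((Module.finrank ℝ E / 2 : ℝ)) : ℂ) := by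
    push_cast; congr 1; ring
  rw [h2, inv_mul_cancel₀ hpi, one_mul, Complex.I_sq]
  congr 1; ring

theorem integral_stdGaussian (f : E → ℝ) :
    ∫ x, f x ∂(stdGaussian E) = ∫ x, stdGaussianDensity x * f x := by
  rw [stdGaussian_eq_withDensity, integral_withDensity_eq_integral_toReal_smul
    continuous_stdGaussianDensity.measurable.ennreal_ofReal (by simp)]
  simp only [ENNReal.toReal_ofReal (stdGaussianDensity_nonneg _), smul_eq_mul]

theorem integrable_stdGaussian_iff (f : E → ℝ) :
    Integrable f (stdGaussian E) ↔ Integrable fun x => stdGaussianDensity x * f x := by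
  rw [stdGaussian_eq_withDensity, integrable_withDensity_iff_integrable_smul'
    continuous_stdGaussianDensity.measurable.ennreal_ofReal (by simp)]
  simp only [ENNReal.toReal_ofReal (stdGaussianDensity_nonneg _), smul_eq_mul]

theorem integrable_comp_of_det_ne_zero {A : E →L[ℝ] E} (hA : LinearMap.det A.toLinearMap ≠ 0)
    {f : E → ℝ} (hf : Integrable f) : Integrable (fun z => f (A z)) ∧
      ∫ z, f (A z) = |(LinearMap.det A.toLinearMap)⁻¹| * ∫ z, f z := by
  have h := Measure.map_linearMap_addHaar_eq_smul_addHaar (volume : Measure E) hA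
  have hA' : Measurable A := A.continuous.measurable
  have hm : AEStronglyMeasurable f (volume.map A) := by
    have : AEStronglyMeasurable f (volume.map A.toLinearMap) := by
      rw [h]; exact hf.1.smul_measure _
    exact this
  have hi : Integrable f (volume.map A) := by
    have : Integrable f (volume.map A.toLinearMap) := by
      rw [h]; exact hf.smul_measure ENNReal.ofReal_ne_top
    exact this
  refine ⟨(integrable_map_measure hm hA'.aemeasurable).1 hi, ?_⟩
  rw [← integral_map hA'.aemeasurable hm]
  calc _ = ∫ z, f z ∂(volume.map A.toLinearMap) := rfl
    _ = _ := by
      rw [h, integral_smul_measure, ENNReal.toReal_ofReal (abs_nonneg _), smul_eq_mul]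

/-- The relative density of `A⁻¹ 𝒩(x, s)` with respect to the standard Gaussian integrates to one,
up to normalisation. -/
theorem integral_exp_sub_stdGaussian {A : E →L[ℝ] E} (hA : LinearMap.det A.toLinearMap ≠ 0)
    (x : E) {s : ℝ} (hs : 0 < s) :
    Integrable (fun z => Real.exp (‖z‖ ^ 2 / 2 - ‖A z - x‖ ^ 2 / (2 * s))) (stdGaussian E) ∧
    ∫ z, Real.exp (‖z‖ ^ 2 / 2 - ‖A z - x‖ ^ 2 / (2 * s)) ∂(stdGaussian E)
      = s ^ (Module.finrank ℝ E / 2 : ℝ) / |LinearMap.det A.toLinearMap| := by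
  have e : ∀ z : E, stdGaussianDensity z * Real.exp (‖z‖ ^ 2 / 2 - ‖A z - x‖ ^ 2 / (2 * s))
      = ((2 * Real.pi) ^ (Module.finrank ℝ E / 2 : ℝ))⁻¹ *
        Real.exp (-(1 / (2 * s)) * ‖A z - x‖ ^ 2) := fun z => by
    rw [stdGaussianDensity, mul_assoc, ← Real.exp_add]
    congr 2; ring
  have hb : 0 < 1 / (2 * s) := by positivity
  have h1 : Integrable fun y : E => Real.exp (-(1 / (2 * s)) * ‖y - x‖ ^ 2) :=
    (integrable_exp_neg_mul_sq_norm (E := E) hb).comp_sub_right x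
  have h2 := integrable_comp_of_det_ne_zero hA h1
  have h3 : ∫ y : E, Real.exp (-(1 / (2 * s)) * ‖y - x‖ ^ 2)
      = (2 * Real.pi) ^ (Module.finrank ℝ E / 2 : ℝ) * s ^ (Module.finrank ℝ E / 2 : ℝ) := by
    rw [integral_sub_right_eq_self (fun y : E => Real.exp (-(1 / (2 * s)) * ‖y‖ ^ 2)) x,
      GaussianFourier.integral_rexp_neg_mul_sq_norm hb, ← Real.mul_rpow (by positivity) hs.le]
    congr 1; field_simp
  rw [integrable_stdGaussian_iff, integral_stdGaussian]
  simp_rw [e]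
  refine ⟨h2.1.const_mul _, ?_⟩
  rw [integral_const_mul, h2.2, h3, abs_inv]
  have : (2 * Real.pi) ^ (Module.finrank ℝ E / 2 : ℝ) ≠ 0 := by positivity
  field_simp

omit [FiniteDimensional ℝ E] in
theorem measurable_iInf_sq_norm_sub {k : ℕ} (x : Fin k → E) {A : E →L[ℝ] E} :
    Measurable fun z => ⨅ j, ‖A z - x j‖ ^ 2 :=
  Measurable.iInf fun j => by fun_prop

theorem integrable_sq_norm_sub {μ : Measure E} [IsGaussian μ] (A : E →L[ℝ] E) (x : E) :
    Integrable (fun z => ‖A z - x‖ ^ 2) μ := by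
  have h : MemLp (fun z => A z - x) 2 μ :=
    ((IsGaussian.memLp_two_id (μ := μ)).continuousLinearMap_comp A).sub (memLp_const x)
  exact h.integrable_norm_pow (by norm_num)

omit [InnerProductSpace ℝ E] [FiniteDimensional ℝ E] [MeasurableSpace E] [BorelSpace E] in
theorem iInf_sq_norm_sub_nonneg {k : ℕ} (x : Fin k → E) (y : E) : 0 ≤ ⨅ j, ‖y - x j‖ ^ 2 :=
  Real.iInf_nonneg fun _ => sq_nonneg _

omit [InnerProductSpace ℝ E] [FiniteDimensional ℝ E] [MeasurableSpace E] [BorelSpace E] in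
theorem bddBelow_sq_norm_sub {k : ℕ} (x : Fin k → E) (y : E) :
    BddBelow (Set.range fun j => ‖y - x j‖ ^ 2) := Set.finite_range _ |>.bddBelow

theorem integrable_iInf_sq_norm_sub {μ : Measure E} [IsGaussian μ] {k : ℕ} (hk : 0 < k)
    (A : E →L[ℝ] E) (x : Fin k → E) : Integrable (fun z => ⨅ j, ‖A z - x j‖ ^ 2) μ := by
  refine (integrable_sq_norm_sub (μ := μ) A (x ⟨0, hk⟩)).mono'
    (measurable_iInf_sq_norm_sub x).aestronglyMeasurable (.of_forall fun z => ?_)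
  rw [Real.norm_eq_abs, abs_of_nonneg (iInf_sq_norm_sub_nonneg _ _)]
  exact ciInf_le (bddBelow_sq_norm_sub x (A z)) _

/-- The Shannon lower bound for `k` points, in the form given by Gibbs' inequality: the law of the
Gaussian vector `A z` is compared with the uniform mixture of the Gaussians `𝒩(xⱼ, s)`. -/
theorem exp_sub_le_of_quantizer {A : E →L[ℝ] E} (hA : LinearMap.det A.toLinearMap ≠ 0) {k : ℕ}
    (hk : 0 < k) (x : Fin k → E) {s : ℝ} (hs : 0 < s) :
    Real.exp ((∫ z, ‖z‖ ^ 2 ∂(stdGaussian E)) / 2 -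
        (∫ z, ⨅ j, ‖A z - x j‖ ^ 2 ∂(stdGaussian E)) / (2 * s))
      ≤ k * (s ^ (Module.finrank ℝ E / 2 : ℝ) / |LinearMap.det A.toLinearMap|) := by
  have : Nonempty (Fin k) := ⟨⟨0, hk⟩⟩
  set φ : E → ℝ := fun z => ‖z‖ ^ 2 / 2 - (⨅ j, ‖A z - x j‖ ^ 2) / (2 * s) with hφ
  have hint1 : Integrable (fun z : E => ‖z‖ ^ 2) (stdGaussian E) := by
    simpa using integrable_sq_norm_sub (μ := stdGaussian E) (ContinuousLinearMap.id ℝ E) 0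
  have hint2 := integrable_iInf_sq_norm_sub (μ := stdGaussian E) hk A x
  have hφi : Integrable φ (stdGaussian E) := (hint1.div_const 2).sub (hint2.div_const _)
  have hle : ∀ z, Real.exp (φ z) ≤ ∑ j, Real.exp (‖z‖ ^ 2 / 2 - ‖A z - x j‖ ^ 2 / (2 * s)) := by
    intro z
    obtain ⟨j, hj⟩ := exists_eq_ciInf_of_finite (f := fun j => ‖A z - x j‖ ^ 2)
    simp only [hφ, ← hj]
    exact Finset.single_le_sum (f := fun j => Real.exp (‖z‖ ^ 2 / 2 - ‖A z - x j‖ ^ 2 / (2 * s)))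
      (fun _ _ => (Real.exp_pos _).le) (Finset.mem_univ j)
  have hsum : Integrable (fun z => ∑ j, Real.exp (‖z‖ ^ 2 / 2 - ‖A z - x j‖ ^ 2 / (2 * s)))
      (stdGaussian E) :=
    integrable_finsetSum _ fun j _ => (integral_exp_sub_stdGaussian hA (x j) hs).1
  have hφm : Measurable φ := by
    have := measurable_iInf_sq_norm_sub x (A := A)
    fun_prop
  have hexp : Integrable (fun z => Real.exp (φ z)) (stdGaussian E) :=
    hsum.mono' hφm.exp.aestronglyMeasurable (.of_forall fun z => by
      rw [Real.norm_eq_abs, abs_of_pos (Real.exp_pos _)]; exact hle z)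
  have hJ : Real.exp (∫ z, φ z ∂(stdGaussian E)) ≤ ∫ z, Real.exp (φ z) ∂(stdGaussian E) :=
    convexOn_exp.map_integral_le Real.continuous_exp.continuousOn isClosed_univ (by simp) hφi hexp
  have hφint : ∫ z, φ z ∂(stdGaussian E) = (∫ z, ‖z‖ ^ 2 ∂(stdGaussian E)) / 2 -
        (∫ z, ⨅ j, ‖A z - x j‖ ^ 2 ∂(stdGaussian E)) / (2 * s) := by
    rw [hφ, integral_sub (hint1.div_const 2) (hint2.div_const _), integral_div, integral_div]
  rw [← hφint]
  refine hJ.trans ((integral_mono hexp hsum hle).trans ?_)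
  rw [integral_finsetSum _ fun j _ => (integral_exp_sub_stdGaussian hA (x j) hs).1]
  simp [(integral_exp_sub_stdGaussian hA _ hs).2]

end GaussianDensity

section Distortion

variable {d : ℕ}

theorem integral_sq_norm_multivariateGaussian {S : Matrix (Fin d) (Fin d) ℝ} (hS : S.PosSemidef) :
    ∫ ξ, ‖ξ‖ ^ 2 ∂(multivariateGaussian (0 : EuclideanSpace ℝ (Fin d)) S) = S.trace := by
  set μ := multivariateGaussian (0 : EuclideanSpace ℝ (Fin d)) S
  have hmem : ∀ i, MemLp (fun ξ : EuclideanSpace ℝ (Fin d) => ξ i) 2 μ := fun i =>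
    (IsGaussian.memLp_two_id (μ := μ)).continuousLinearMap_comp
      (EuclideanSpace.proj i : EuclideanSpace ℝ (Fin d) →L[ℝ] ℝ)
  have hmean : ∀ i, ∫ ξ, ξ.ofLp i ∂μ = 0 := fun i => by
    have h := ContinuousLinearMap.integral_comp_comm (μ := μ)
      (EuclideanSpace.proj (𝕜 := ℝ) i : EuclideanSpace ℝ (Fin d) →L[ℝ] ℝ)
      (IsGaussian.integrable_fun_id)
    rw [integral_id_multivariateGaussian] at h
    simpa using h
  simp_rw [EuclideanSpace.real_norm_sq_eq]
  rw [integral_finsetSum _ fun i _ => (hmem i).integrable_sq, Matrix.trace]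
  refine Finset.sum_congr rfl fun i _ => ?_
  rw [Matrix.diag_apply, ← variance_eval_multivariateGaussian (μ := 0) hS i,
    variance_of_integral_eq_zero (hmem i).1.aemeasurable (hmean i)]

theorem bddBelow_range_integral_iInf (k : ℕ) (μ : Measure (EuclideanSpace ℝ (Fin d))) :
    BddBelow (Set.range fun x : Fin k → EuclideanSpace ℝ (Fin d) =>
      ∫ ξ, (⨅ j, ‖ξ - x j‖ ^ 2) ∂μ) :=
  ⟨0, by rintro _ ⟨x, rfl⟩; exact integral_nonneg fun ξ => iInf_sq_norm_sub_nonneg x ξ⟩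

theorem distortion_le_trace {k : ℕ} (hk : 0 < k) {S : Matrix (Fin d) (Fin d) ℝ}
    (hS : S.PosSemidef) : distortion k S ≤ S.trace := by
  have : Nonempty (Fin k) := ⟨⟨0, hk⟩⟩
  refine (ciInf_le (bddBelow_range_integral_iInf k _) fun _ => 0).trans_eq ?_
  simp [integral_sq_norm_multivariateGaussian hS]

open scoped MatrixOrder Matrix.Norms.L2Operator in
/-- The Shannon lower bound on the distortion of a `k`-point quantizer of a Gaussian vector. -/
theorem mul_det_rpow_le_distortion (hd : 0 < d) {k : ℕ} (hk : 0 < k)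
    {S : Matrix (Fin d) (Fin d) ℝ} (hS : S.PosDef) :
    d * S.det ^ (1 / (d : ℝ)) * ((k : ℝ) ^ (2 / (d : ℝ)))⁻¹ ≤ distortion k S := by
  have hd' : (0 : ℝ) < d := by exact_mod_cast hd
  have hk' : (0 : ℝ) < k := by exact_mod_cast hk
  have hdet := hS.det_pos
  refine le_ciInf fun x => ?_
  set A := toEuclideanCLM (n := Fin d) (𝕜 := ℝ) (CFC.sqrt S)
  have hAdet : LinearMap.det A.toLinearMap = Real.sqrt S.det := by
    have h : LinearMap.det A.toLinearMap = (CFC.sqrt S).det := by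
      rw [coe_toEuclideanCLM_eq_toEuclideanLin, toEuclideanLin_eq_toLin_orthonormal,
        LinearMap.det_toLin]
    rw [h, hS.posSemidef.det_sqrt, RCLike.sqrt_of_nonneg hdet.le]
    simp
  have hA0 : LinearMap.det A.toLinearMap ≠ 0 := by rw [hAdet]; positivity
  have hD : ∫ ξ, (⨅ j, ‖ξ - x j‖ ^ 2) ∂(multivariateGaussian (0 : EuclideanSpace ℝ (Fin d)) S)
      = ∫ z, ⨅ j, ‖A z - x j‖ ^ 2 ∂(stdGaussian (EuclideanSpace ℝ (Fin d))) := by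
    rw [multivariateGaussian, integral_map (by fun_prop)]
    · simp only [zero_add]; rfl
    · exact (measurable_iInf_sq_norm_sub x
        (A := ContinuousLinearMap.id ℝ (EuclideanSpace ℝ (Fin d)))).aestronglyMeasurable
  have hstd : ∫ z, ‖z‖ ^ 2 ∂(stdGaussian (EuclideanSpace ℝ (Fin d))) = d := by
    rw [← multivariateGaussian_zero_one, integral_sq_norm_multivariateGaussian PosSemidef.one]
    simp
  rw [hD]
  set D := ∫ z, ⨅ j, ‖A z - x j‖ ^ 2 ∂(stdGaussian (EuclideanSpace ℝ (Fin d))) with hDdef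
  have hD0 : 0 ≤ D := integral_nonneg fun z => iInf_sq_norm_sub_nonneg x (A z)
  set b := S.det ^ (1 / (d : ℝ)) * ((k : ℝ) ^ (2 / (d : ℝ)))⁻¹ with hb
  have hb0 : 0 < b := by positivity
  have hbpow : k * b ^ ((d : ℝ) / 2) = Real.sqrt S.det := by
    rw [hb, Real.mul_rpow (by positivity) (by positivity), Real.inv_rpow (by positivity),
      ← Real.rpow_mul hdet.le, ← Real.rpow_mul hk'.le, Real.sqrt_eq_rpow,
      show 2 / (d : ℝ) * (d / 2) = 1 by field_simp, show 1 / (d : ℝ) * (d / 2) = 1 / 2 by field_simp,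
      Real.rpow_one]
    field_simp
  rw [mul_assoc]
  by_contra! hlt
  -- A level `s` strictly between `D / d` and the claimed bound contradicts Gibbs' inequality.
  set s := (D / d + b) / 2 with hs
  have hDb : D / d < b := by rwa [div_lt_iff₀ hd', mul_comm]
  have hs0 : 0 < s := by positivity
  have key := exp_sub_le_of_quantizer hA0 hk x hs0
  rw [hstd, ← hDdef, hAdet, abs_of_nonneg (Real.sqrt_nonneg _), finrank_euclideanSpace_fin] at key
  have h1 : 1 ≤ Real.exp ((d : ℝ) / 2 - D / (2 * s)) := by
    refine Real.one_le_exp ?_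
    rw [sub_nonneg, div_le_div_iff₀ (by positivity) two_pos]
    have : D / d < s := by rw [hs]; linarith
    rw [div_lt_iff₀ hd'] at this
    nlinarith
  have h2 : s ^ ((d : ℝ) / 2) < b ^ ((d : ℝ) / 2) :=
    Real.rpow_lt_rpow hs0.le (by rw [hs]; linarith) (by positivity)
  have h3 : (1 : ℝ) ≤ k * s ^ ((d : ℝ) / 2) / Real.sqrt S.det := by
    rw [mul_div_assoc]; exact h1.trans key
  rw [le_div_iff₀ (Real.sqrt_pos.2 hdet), one_mul, ← hbpow] at h3
  exact absurd h3 (not_le.2 (mul_lt_mul_of_pos_left h2 hk'))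

end Distortion

/-! ### The isoperimetric ratio -/

section Isoperimetric

variable {d : ℕ}

theorem isoperimetricRatio_ofSpectrum
    (v : OrthonormalBasis (Fin d) ℝ (EuclideanSpace ℝ (Fin d))) (c : Fin d → ℝ) :
    isoperimetricRatio (ofSpectrum v c) = (∑ i, c i) / (d * (∏ i, c i) ^ (1 / (d : ℝ))) := by
  rw [isoperimetricRatio, trace_ofSpectrum, det_ofSpectrum]

/-- The inequality of arithmetic and geometric means for the eigenvalues. -/
theorem one_le_isoperimetricRatio (hd : 0 < d) {S : Matrix (Fin d) (Fin d) ℝ} (hS : S.PosDef) :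
    1 ≤ isoperimetricRatio S ∧
      (isoperimetricRatio S = 1 ↔ ∃ c : ℝ, S = c • (1 : Matrix (Fin d) (Fin d) ℝ)) := by
  have hd' : (0 : ℝ) < d := by exact_mod_cast hd
  set u := hS.1.eigenvectorBasis
  set e := hS.1.eigenvalues
  have he : ∀ i, 0 < e i := hS.eigenvalues_pos
  have hSe : S = ofSpectrum u e := exists_eq_ofSpectrum hS.1
  have hw : ∑ _i : Fin d, (1 / (d : ℝ)) = 1 := by simp [hd'.ne']
  have hratio : isoperimetricRatio S
      = (∑ i, 1 / (d : ℝ) * e i) / ∏ i, e i ^ (1 / (d : ℝ)) := by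
    rw [hSe, isoperimetricRatio_ofSpectrum, ← Finset.mul_sum,
      Real.finsetProd_rpow _ _ fun i _ => (he i).le]
    field_simp
  have hprod : 0 < ∏ i, e i ^ (1 / (d : ℝ)) :=
    Finset.prod_pos fun i _ => Real.rpow_pos_of_pos (he i) _
  refine ⟨?_, fun h => ?_, ?_⟩
  · rw [hratio, one_le_div hprod]
    exact Real.geom_mean_le_arith_mean_weighted _ _ _ (fun _ _ => by positivity) hw
      fun i _ => (he i).le
  · rw [hratio, div_eq_one_iff_eq hprod.ne', eq_comm,
      Real.geom_mean_eq_arith_mean_weighted_iff_of_pos _ _ _ (fun _ _ => by positivity) hw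
        fun i _ => (he i).le] at h
    refine ⟨e ⟨0, hd⟩, ?_⟩
    rw [hSe, ← ofSpectrum_const u]
    congr 1
    ext i
    exact h i (Finset.mem_univ _) _ (Finset.mem_univ _)
  · rintro ⟨c, rfl⟩
    have hc : 0 < c := by simpa using hS.diag_pos (i := ⟨0, hd⟩)
    rw [isoperimetricRatio, trace_smul, trace_one, det_smul, det_one, Fintype.card_fin, mul_one,
      one_div, Real.pow_rpow_inv_natCast hc.le hd.ne', smul_eq_mul, mul_comm c]
    exact div_self (by positivity)

end Isoperimetric

/-! ### The ratio as a function of the budget -/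

section Levels

theorem le_of_hasDerivWithinAt_Ici_nonneg {h h' : ℝ → ℝ} {a b : ℝ} (hab : a ≤ b)
    (hc : ContinuousOn h (Set.Icc a b))
    (hd : ∀ t ∈ Set.Ico a b, HasDerivWithinAt h (h' t) (Set.Ici t) t)
    (hn : ∀ t ∈ Set.Ico a b, 0 ≤ h' t) : h a ≤ h b :=
  image_le_of_deriv_right_le_deriv_boundary (f := fun _ => h a) (f' := fun _ => 0) (B := h)
    continuousOn_const (fun _ _ => hasDerivWithinAt_const _ _ _) le_rfl hc hd hn
    (Set.right_mem_Icc.2 hab)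

theorem hasDerivWithinAt_max (p t : ℝ) :
    HasDerivWithinAt (fun s => max s p) (if p ≤ t then 1 else 0) (Set.Ici t) t := by
  split_ifs with h
  · exact (hasDerivWithinAt_id t _).congr (fun s hs => max_eq_left (h.trans hs)) (max_eq_left h)
  · have h' : t < p := not_le.1 h
    refine ((hasDerivAt_const t p).congr_of_eventuallyEq ?_).hasDerivWithinAt
    filter_upwards [Iio_mem_nhds h'] with s hs
    exact max_eq_right (le_of_lt hs)

variable {d : ℕ} (p : Fin d → ℝ)

/-- The total precision needed to raise all the prior precisions `p` to at least `t`. -/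
def fillingCost (t : ℝ) : ℝ := ∑ i, (max t (p i) - p i)

/-- The isoperimetric ratio of a covariance with precisions `max t (p i)`. -/
noncomputable def fillingRatio (t : ℝ) : ℝ :=
  (d : ℝ)⁻¹ * ((∑ i, (max t (p i))⁻¹) * Real.exp ((d : ℝ)⁻¹ * ∑ i, Real.log (max t (p i))))

/-- The derivative of `fillingRatio` with respect to `fillingCost`. -/
noncomputable def fillingSlope (t : ℝ) : ℝ :=
  -(((d : ℝ)⁻¹) ^ 2 * (Real.exp ((d : ℝ)⁻¹ * ∑ i, Real.log (max t (p i) / t)) *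
    ∑ i, (t⁻¹ - (max t (p i))⁻¹)))

/-- The number of precisions that are at most `t`. -/
noncomputable def activeCount (t : ℝ) : ℝ := ∑ i, if p i ≤ t then 1 else 0

variable {p}

theorem activeCount_nonneg (t : ℝ) : 0 ≤ activeCount p t :=
  Finset.sum_nonneg fun i _ => by split_ifs <;> norm_num

theorem hasDerivWithinAt_fillingCost (t : ℝ) :
    HasDerivWithinAt (fillingCost p) (activeCount p t) (Set.Ici t) t :=
  HasDerivWithinAt.fun_sum fun i _ => (hasDerivWithinAt_max (p i) t).sub_const (p i)

theorem hasDerivWithinAt_fillingRatio (hd : 0 < d) {t : ℝ} (ht : 0 < t) :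
    HasDerivWithinAt (fillingRatio p) (activeCount p t * fillingSlope p t) (Set.Ici t) t := by
  have hd' : (d : ℝ) ≠ 0 := by exact_mod_cast hd.ne'
  have hx : ∀ i, 0 < max t (p i) := fun i => lt_max_of_lt_left ht
  have hc : ∀ i, (if p i ≤ t then (1 : ℝ) else 0) / max t (p i) = (if p i ≤ t then 1 else 0) / t :=
    fun i => by
      split_ifs with h
      · rw [max_eq_left h]
      · simp
  have hsum : HasDerivWithinAt (fun s => ∑ i, (max s (p i))⁻¹) (-(activeCount p t) / t ^ 2)
      (Set.Ici t) t := by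
    have h := HasDerivWithinAt.fun_sum (u := Finset.univ) fun i _ =>
      (hasDerivWithinAt_max (p i) t).fun_inv (hx i).ne'
    refine h.congr_deriv ?_
    rw [activeCount, neg_div, Finset.sum_div, ← Finset.sum_neg_distrib]
    refine Finset.sum_congr rfl fun i _ => ?_
    split_ifs with hi
    · rw [max_eq_left hi, neg_div]
    · simp
  have hlog : HasDerivWithinAt (fun s => ∑ i, Real.log (max s (p i))) (activeCount p t / t)
      (Set.Ici t) t := by
    have h := HasDerivWithinAt.fun_sum (u := Finset.univ) fun i _ =>
      (hasDerivWithinAt_max (p i) t).log (hx i).ne'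
    refine h.congr_deriv ?_
    simp_rw [hc]
    rw [activeCount, Finset.sum_div]
  have hE : Real.exp ((d : ℝ)⁻¹ * ∑ i, Real.log (max t (p i) / t))
      = Real.exp ((d : ℝ)⁻¹ * ∑ i, Real.log (max t (p i))) / t := by
    have : ∀ i, Real.log (max t (p i) / t) = Real.log (max t (p i)) - Real.log t := fun i =>
      Real.log_div (hx i).ne' ht.ne'
    simp_rw [this]
    rw [Finset.sum_sub_distrib, mul_sub, Finset.sum_const, Finset.card_univ, Fintype.card_fin,
      nsmul_eq_mul, ← mul_assoc, inv_mul_cancel₀ hd', one_mul, Real.exp_sub, Real.exp_log ht]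
  refine (((hsum.fun_mul ((hlog.const_mul (d : ℝ)⁻¹).exp)).const_mul (d : ℝ)⁻¹)).congr_deriv ?_
  rw [fillingSlope, hE, Finset.sum_sub_distrib, Finset.sum_const, Finset.card_univ,
    Fintype.card_fin, nsmul_eq_mul]
  field_simp
  ring

theorem continuous_fillingCost : Continuous (fillingCost p) := by
  unfold fillingCost; fun_prop

theorem continuousOn_fillingRatio {a b : ℝ} (ha : 0 < a) :
    ContinuousOn (fillingRatio p) (Set.Icc a b) := by
  have hx : ∀ i, ∀ t ∈ Set.Icc a b, max t (p i) ≠ 0 := fun i t ht =>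
    (lt_max_of_lt_left (ha.trans_le ht.1)).ne'
  have hm : ∀ i, ContinuousOn (fun t => max t (p i)) (Set.Icc a b) := fun i => by fun_prop
  refine continuousOn_const.mul ((continuousOn_finsetSum _ fun i _ => (hm i).inv₀ (hx i)).mul ?_)
  exact (continuousOn_const.mul (continuousOn_finsetSum _ fun i _ => (hm i).log (hx i))).rexp

/-- The slope is increasing: both the geometric and the arithmetic factor of its negative measure
how far the precisions exceed the level `t`. -/
theorem fillingSlope_mono {s t : ℝ} (hs : 0 < s) (hst : s ≤ t) :
    fillingSlope p s ≤ fillingSlope p t := by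
  have ht := hs.trans_le hst
  have hgap : ∀ i, ∀ t, 0 < t → 0 ≤ t⁻¹ - (max t (p i))⁻¹ := fun i t ht =>
    sub_nonneg.2 (inv_anti₀ ht (le_max_left _ _))
  unfold fillingSlope
  refine neg_le_neg (mul_le_mul_of_nonneg_left (mul_le_mul ?_ ?_
    (Finset.sum_nonneg fun i _ => hgap i t ht) (Real.exp_pos _).le) (sq_nonneg _))
  · refine Real.exp_le_exp.2 (mul_le_mul_of_nonneg_left (Finset.sum_le_sum fun i _ => ?_)
      (by positivity))
    have h1 : 0 < max t (p i) := lt_max_of_lt_left ht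
    refine Real.log_le_log (by positivity) ?_
    rw [div_le_div_iff₀ ht hs]
    rcases le_total (p i) t with h | h
    · rw [max_eq_left h, mul_comm]
      exact mul_le_mul_of_nonneg_right (le_max_left _ _) ht.le
    · rw [max_eq_right h, max_eq_right (hst.trans h)]
      exact mul_le_mul_of_nonneg_left hst (ht.le.trans h)
  · refine Finset.sum_le_sum fun i _ => ?_
    rcases le_total (p i) t with h | h
    · rw [max_eq_left h, sub_self]; exact hgap i s hs
    · rw [max_eq_right h, max_eq_right (hst.trans h)]
      exact sub_le_sub_right (inv_anti₀ hs hst) _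

theorem fillingSlope_nonpos {t : ℝ} (ht : 0 < t) : fillingSlope p t ≤ 0 := by
  refine neg_nonpos.2 (mul_nonneg (sq_nonneg _) (mul_nonneg (Real.exp_pos _).le
    (Finset.sum_nonneg fun i _ => sub_nonneg.2 (inv_anti₀ ht (le_max_left _ _)))))

/-- The supporting line of the ratio as a function of the cost. -/
theorem fillingRatio_tangent (hd : 0 < d) {s t : ℝ} (hs : 0 < s) (ht : 0 < t) :
    fillingRatio p s + fillingSlope p s * (fillingCost p t - fillingCost p s)
      ≤ fillingRatio p t := by
  rcases le_total s t with hst | hst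
  · have := le_of_hasDerivWithinAt_Ici_nonneg
      (h := fun r => fillingRatio p r - fillingSlope p s * fillingCost p r)
      (h' := fun r => activeCount p r * fillingSlope p r - fillingSlope p s * activeCount p r) hst
      ((continuousOn_fillingRatio hs).sub (continuous_fillingCost.const_mul _).continuousOn)
      (fun r hr => (hasDerivWithinAt_fillingRatio hd (hs.trans_le hr.1)).sub
        ((hasDerivWithinAt_fillingCost r).const_mul _))
      (fun r hr => by
        have h1 := fillingSlope_mono (p := p) hs hr.1
        nlinarith [activeCount_nonneg (p := p) r])
    linarith
  · have := le_of_hasDerivWithinAt_Ici_nonneg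
      (h := fun r => fillingSlope p s * fillingCost p r - fillingRatio p r)
      (h' := fun r => fillingSlope p s * activeCount p r - activeCount p r * fillingSlope p r) hst
      ((continuous_fillingCost.const_mul _).continuousOn.sub (continuousOn_fillingRatio ht))
      (fun r hr => ((hasDerivWithinAt_fillingCost r).const_mul _).sub
        (hasDerivWithinAt_fillingRatio hd (ht.trans_le hr.1)))
      (fun r hr => by
        have h1 := fillingSlope_mono (p := p) (ht.trans_le hr.1) hr.2.le
        nlinarith [activeCount_nonneg (p := p) r])
    linarith

end Levels

/-! ### Water-filling with real budgets -/

section Budget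

variable {d : ℕ} (v : OrthonormalBasis (Fin d) ℝ (EuclideanSpace ℝ (Fin d))) {l : Fin d → ℝ}
  {σ : ℝ}

/-- For a budget of at least `d`, water-filling raises the precisions to a common level whose cost
is the whole budget. -/
theorem exists_filling_level (hd : 0 < d) (hl : ∀ i, 0 < l i) (hanti : Antitone l) (hσ : 0 < σ)
    {m : ℝ} (hm : d ≤ m) : ∃ t, 0 < t ∧ fillingCost (fun i => (l i)⁻¹) t = m / σ ^ 2 ∧
      isoperimetricRatio (waterFillingPosterior v l σ m) = fillingRatio (fun i => (l i)⁻¹) t := by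
  have hd' : (0 : ℝ) < d := by exact_mod_cast hd
  have hr := isWaterFillingRank_waterFillingRank (m := m) hl hanti hσ
  have hcap : min ⌊m⌋₊ d = d := min_eq_right (Nat.le_floor hm)
  have hrd : waterFillingRank l σ m ≤ d := hr.1.trans (min_le_right _ _)
  have hcase : waterFillingRank l σ m < min ⌊m⌋₊ d ∨ waterFillingRank l σ m = d := by omega
  have hr0 : 0 < waterFillingRank l σ m := by
    rcases hcase with h | h
    · exact rank_pos_of_lt hl hr h
    · omega
  have hmin := waterFillingEigenvalue_eq_min hl hanti hσ hcase
  have hlev := equalizationLevel_mul hl hσ hr hr0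
  have hpos := equalizationLevel_pos hl hσ hr hr0
  rw [waterFillingPosterior_eq, isoperimetricRatio_ofSpectrum]
  set w := waterFillingEigenvalue l σ m with hwdef
  set r := waterFillingRank l σ m
  set c := equalizationLevel l σ m r
  have hw : ∀ i, w i = (max c⁻¹ (l i)⁻¹)⁻¹ := fun i => by
    rw [hmin]
    rcases le_total c (l i) with h | h
    · rw [min_eq_left h, max_eq_left (inv_anti₀ hpos h), inv_inv]
    · rw [min_eq_right h, max_eq_right (inv_anti₀ (hl i) h), inv_inv]
  have hwpos : ∀ i, 0 < w i := waterFillingEigenvalue_pos hl hanti hσ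
  refine ⟨c⁻¹, inv_pos.2 hpos, ?_, ?_⟩
  · have h : ∀ i, max c⁻¹ (l i)⁻¹ - (l i)⁻¹ = if i.val < r then c⁻¹ - (l i)⁻¹ else 0 := fun i => by
      rw [← inv_inv (max c⁻¹ (l i)⁻¹), ← hw, hwdef]
      unfold waterFillingEigenvalue
      split_ifs
      · rfl
      · exact sub_self _
    simp only [fillingCost, h]
    rw [← Finset.sum_filter, Finset.sum_sub_distrib, Finset.sum_const, card_filter_val_lt hrd,
      nsmul_eq_mul, ← hlev]
    field_simp
    ring
  · have hlog : ∀ i, Real.log (max c⁻¹ (l i)⁻¹) = -Real.log (w i) := fun i => by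
      rw [hw, Real.log_inv, neg_neg]
    simp only [fillingRatio, ← hw, hlog]
    have hprod : 0 < ∏ i, w i := Finset.prod_pos fun i _ => hwpos i
    rw [Finset.sum_neg_distrib, ← Real.log_prod fun i _ => (hwpos i).ne', mul_neg, Real.exp_neg,
      Real.rpow_def_of_pos hprod, one_div, mul_comm (Real.log _)]
    field_simp

theorem convexOn_isoperimetricRatio (hd : 0 < d) (hl : ∀ i, 0 < l i) (hanti : Antitone l)
    (hσ : 0 < σ) : ConvexOn ℝ (Set.Ici (d : ℝ))
      fun m => isoperimetricRatio (waterFillingPosterior v l σ m) := by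
  refine ⟨convex_Ici _, fun x hx y hy a b ha hb hab => ?_⟩
  obtain ⟨tx, htx, hcx, hfx⟩ := exists_filling_level v hd hl hanti hσ hx
  obtain ⟨ty, hty, hcy, hfy⟩ := exists_filling_level v hd hl hanti hσ hy
  obtain ⟨tz, htz, hcz, hfz⟩ := exists_filling_level v hd hl hanti hσ
    (convex_Ici (𝕜 := ℝ) _ hx hy ha hb hab)
  simp only [smul_eq_mul] at hfz hcz ⊢
  rw [hfx, hfy, hfz]
  have h1 := mul_le_mul_of_nonneg_left
    (fillingRatio_tangent (p := fun i => (l i)⁻¹) hd htz htx) ha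
  have h2 := mul_le_mul_of_nonneg_left
    (fillingRatio_tangent (p := fun i => (l i)⁻¹) hd htz hty) hb
  rw [hcx, hcz] at h1
  rw [hcy, hcz] at h2
  have hb' : b = 1 - a := by linarith
  subst hb'
  refine le_trans (le_of_eq ?_) (add_le_add h1 h2)
  ring

theorem antitoneOn_isoperimetricRatio (hd : 0 < d) (hl : ∀ i, 0 < l i) (hanti : Antitone l)
    (hσ : 0 < σ) : AntitoneOn (fun m => isoperimetricRatio (waterFillingPosterior v l σ m))
      (Set.Ici (d : ℝ)) := by
  intro x hx y hy hxy
  obtain ⟨tx, htx, hcx, hfx⟩ := exists_filling_level v hd hl hanti hσ hx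
  obtain ⟨ty, hty, hcy, hfy⟩ := exists_filling_level v hd hl hanti hσ hy
  simp only
  rw [hfx, hfy]
  have h := fillingRatio_tangent (p := fun i => (l i)⁻¹) hd hty htx
  rw [hcx, hcy] at h
  have h1 : x / σ ^ 2 - y / σ ^ 2 ≤ 0 := sub_nonpos.2 (by gcongr)
  have := mul_nonneg_of_nonpos_of_nonpos (fillingSlope_nonpos (p := fun i => (l i)⁻¹) hty) h1
  linarith

theorem fillingRatio_eq_one (hd : 0 < d) {p : Fin d → ℝ} {t c : ℝ} (hc : 0 < c)
    (h : ∀ i, max t (p i) = c) : fillingRatio p t = 1 := by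
  have hd' : (d : ℝ) ≠ 0 := by exact_mod_cast hd.ne'
  simp only [fillingRatio, h, Finset.sum_const, Finset.card_univ, Fintype.card_fin, nsmul_eq_mul]
  rw [← mul_assoc (d : ℝ)⁻¹ (d : ℝ) (Real.log c), inv_mul_cancel₀ hd', one_mul, Real.exp_log hc]
  field_simp

/-- Beyond the activation threshold the budget suffices to raise all the precisions to the largest
one, so that they are all equal. -/
theorem isoperimetricRatio_eq_one (hd : 0 < d) (hl : ∀ i, 0 < l i) (hanti : Antitone l)
    (hσ : 0 < σ) {m : ℝ} (hm : max (d : ℝ) (activationThreshold (ofSpectrum v l) l σ) ≤ m) :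
    isoperimetricRatio (waterFillingPosterior v l σ m) = 1 := by
  obtain ⟨t, ht, hcost, hratio⟩ := exists_filling_level v hd hl hanti hσ (le_of_max_le_left hm)
  have : Nonempty (Fin d) := ⟨⟨0, hd⟩⟩
  obtain ⟨j, hj⟩ := exists_eq_ciInf_of_finite (f := l)
  have hle : ∀ i, (l i)⁻¹ ≤ (l j)⁻¹ := fun i =>
    inv_anti₀ (hl j) (hj ▸ ciInf_le (Set.finite_range l).bddBelow i)
  have hm' : (d : ℝ) * (l j)⁻¹ ≤ ∑ i, max t (l i)⁻¹ := by
    have h1 := le_of_max_le_right hm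
    rw [activationThreshold, ofSpectrum_inv v fun i => (hl i).ne', trace_ofSpectrum, ← hj,
      ← le_div_iff₀' (by positivity), ← hcost, fillingCost, Finset.sum_sub_distrib] at h1
    have h2 := (le_max_left _ _).trans h1
    rw [div_eq_mul_inv] at h2
    linarith
  rw [hratio]
  rcases le_total (l j)⁻¹ t with h | h
  · exact fillingRatio_eq_one hd ht fun i => max_eq_left ((hle i).trans h)
  · have hle' : ∀ i ∈ Finset.univ, max t (l i)⁻¹ ≤ (l j)⁻¹ := fun i _ => max_le h (hle i)
    have heq := (Finset.sum_eq_sum_iff_of_le hle').1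
      (le_antisymm (Finset.sum_le_sum hle') (by simpa using hm'))
    exact fillingRatio_eq_one hd (inv_pos.2 (hl j)) fun i => heq i (Finset.mem_univ i)

end Budget

/-! ### The performance ratio -/

/-- The distortion of water-filling is at most its trace; the Shannon lower bound and D-optimality
compare the geometric mean of its eigenvalues with the distortion of any feasible posterior. -/
theorem distortion_waterFilling_le {d : ℕ} (hd : 0 < d)
    (v : OrthonormalBasis (Fin d) ℝ (EuclideanSpace ℝ (Fin d))) {l : Fin d → ℝ} {σ : ℝ}
    (hl : ∀ i, 0 < l i) (hanti : Antitone l) (hσ : 0 < σ) {m k : ℕ} (hk : 0 < k)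
    {S : Matrix (Fin d) (Fin d) ℝ} (hS : IsFeasiblePosterior (ofSpectrum v l) σ m S) :
    distortion k (waterFillingPosterior v l σ m) ≤
      isoperimetricRatio (waterFillingPosterior v l σ m) * (k : ℝ) ^ (2 / (d : ℝ)) *
        distortion k S := by
  have hd' : (0 : ℝ) < d := by exact_mod_cast hd
  have hk' : (0 : ℝ) < k := by exact_mod_cast hk
  have hW : (waterFillingPosterior v l σ m).PosDef :=
    posDef_ofSpectrum v (waterFillingEigenvalue_pos hl hanti hσ)
  have hSpd := hS.posDef (posDef_ofSpectrum v hl)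
  have hdet := det_waterFillingPosterior_le v hl hanti hσ hd hS
  have hlow := mul_det_rpow_le_distortion hd hk hSpd
  refine (distortion_le_trace hk hW.posSemidef).trans ?_
  set W := waterFillingPosterior v l σ m
  have hWdet := hW.det_pos
  have hα : 0 ≤ isoperimetricRatio W := zero_le_one.trans (one_le_isoperimetricRatio hd hW).1
  have hK : 0 < (k : ℝ) ^ (2 / (d : ℝ)) := by positivity
  calc W.trace = isoperimetricRatio W * (k : ℝ) ^ (2 / (d : ℝ)) *
        (d * W.det ^ (1 / (d : ℝ)) * ((k : ℝ) ^ (2 / (d : ℝ)))⁻¹) := by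
        rw [isoperimetricRatio]
        have : W.det ^ (1 / (d : ℝ)) ≠ 0 := by positivity
        field_simp
    _ ≤ _ := by
        refine mul_le_mul_of_nonneg_left (le_trans ?_ hlow) (by positivity)
        gcongr

end SolicitSuggest

theorem proposition5 (d : ℕ) (hd : 1 ≤ d) (σ : ℝ) (hσ : 0 < σ)
    (S₀ : Matrix (Fin d) (Fin d) ℝ) (hS₀ : S₀.PosDef)
    (v : OrthonormalBasis (Fin d) ℝ (EuclideanSpace ℝ (Fin d)))
    (l : Fin d → ℝ) (hl : Antitone l)
    (hspec : S₀ = ∑ i, l i • Matrix.vecMulVec (v i).ofLp (v i).ofLp) :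
    (∀ S : Matrix (Fin d) (Fin d) ℝ, S.PosDef →
      1 ≤ isoperimetricRatio S ∧
      (isoperimetricRatio S = 1 ↔ ∃ c : ℝ, S = c • (1 : Matrix (Fin d) (Fin d) ℝ))) ∧
    (∀ m k : ℕ, 2 ≤ k →
      (∀ S : Matrix (Fin d) (Fin d) ℝ, IsOptimalPosterior k S₀ σ m S →
        0 < distortion k S ∧
        distortion k (waterFillingPosterior v l σ m) / distortion k S ≤
          isoperimetricRatio (waterFillingPosterior v l σ m) * (k : ℝ) ^ (2 / (d : ℝ))) ∧
      (∀ S : Matrix (Fin d) (Fin d) ℝ, IsFeasiblePosterior S₀ σ m S →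
        distortion k (waterFillingPosterior v l σ m) ≤
          isoperimetricRatio (waterFillingPosterior v l σ m) * (k : ℝ) ^ (2 / (d : ℝ)) *
            distortion k S)) ∧
    ConvexOn ℝ (Set.Ici (d : ℝ)) (fun m => isoperimetricRatio (waterFillingPosterior v l σ m)) ∧
    AntitoneOn (fun m => isoperimetricRatio (waterFillingPosterior v l σ m)) (Set.Ici (d : ℝ)) ∧
    (∀ m : ℝ, max (d : ℝ) (activationThreshold S₀ l σ) ≤ m →
      isoperimetricRatio (waterFillingPosterior v l σ m) = 1) := by
  have hS : S₀ = ofSpectrum v l := hspec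
  have hpos : ∀ i, 0 < l i := (posDef_ofSpectrum_iff v l).1 (hS ▸ hS₀)
  subst hS
  refine ⟨fun S h => one_le_isoperimetricRatio hd h, fun m k hk => ⟨fun S hopt => ?_, fun S hS =>
    distortion_waterFilling_le hd v hpos hl hσ (by omega) hS⟩,
    convexOn_isoperimetricRatio v hd hpos hl hσ, antitoneOn_isoperimetricRatio v hd hpos hl hσ,
    fun m hm => isoperimetricRatio_eq_one v hd hpos hl hσ hm⟩
  have hSpd := hopt.1.posDef hS₀
  have hd' : (0 : ℝ) < d := by exact_mod_cast hd
  have hk' : (0 : ℝ) < k := by exact_mod_cast (by omega : 0 < k)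
  have hdet := hSpd.det_pos
  have hD : 0 < distortion k S :=
    lt_of_lt_of_le (by positivity) (mul_det_rpow_le_distortion hd (by omega) hSpd)
  refine ⟨hD, ?_⟩
  rw [div_le_iff₀ hD]
  exact distortion_waterFilling_le hd v hpos hl hσ (by omega) hopt.1
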